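/- **Theorem 2.2.** Let $1<\gamma,\beta\le 2$, $0\le\mu\le1$, and let $\lambda,\xi_0,\xi_1$ be constants (real or complex). For $\alpha>0$ let $$I^{\alpha}g(t)=\frac1{\Gamma(\alpha)}\int_0^t (t-\tau)^{\alpha-1}g(\tau)\,d\tau ,\qquad I^0g=g,$$ and let $$D_t^{(\gamma,\beta)\mu}u=I^{\mu(2-\gamma)}\frac{d^2}{dt^2}I^{(1-\mu)(2-\beta)}u,\qquad E_{a,b}(z)=\sum_{k=0}^\infty\frac{z^k}{\Gamma(ak+b)},\qquad \delta=\beta+\mu(\gamma-\beta).$$ Let $f\in C^1(0,\infty)$ be integrable on $(0,1)$. Consider the problem $$D_t^{(\gamma,\beta)\mu}u(t)+\lambda u(t)=f(t)\quad(t>0),\qquad \lim_{t\to0+}I^{(1-\mu)(2-\beta)}u(t)=\xi_0,\qquad \lim_{t\to0+}\frac{d}{dt}I^{(1-\mu)(2-\beta)}u(t)=\xi_1 .$$ A solution is a function $u$, continuous on $(0,\infty)$ and integrable on $(0,T)$ for every $T>0$, such that $v=I^{(1-\mu)(2-\beta)}u$ is $C^2$ on $(0,\infty)$ with $v''$ integrable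 on $(0,T)$ for every $T>0$, and such that the equation holds for every $t>0$ and both initial conditions hold. Put $$u_*(t)=\xi_0t^{(\beta-2)(1-\mu)}E_{\delta,\delta+\mu(2-\gamma)-1}(-\lambda t^\delta)+\xi_1t^{\mu+(\beta-1)(1-\mu)}E_{\delta,\delta+\mu(2-\gamma)}(-\lambda t^\delta)+\int_0^t(t-\tau)^{\delta-1}E_{\delta,\delta}\big(-\lambda(t-\tau)^\delta\big)f(\tau)\,d\tau .$$ 1. Every solution equals $u_*$ on $(0,\infty)$; in particular there is at most one solution. 2. If $\mu(2-\gamma)=0$, or if $\int_0^1t^{1-\mu(2-\gamma)}|f'(t)|\,dt<\infty$ (which holds for every $f\in C^1[0,\infty)$), then $u_*$ is a solution. So for such $f$, in particular for every $f\in C^1[0,\infty)$, the problem has exactly one solution, and it is $u_*$. -/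

import Mathlib

open Set Filter Topology MeasureTheory

noncomputable section

/-- Two-parameter Mittag-Leffler function `E_{α,β}(z) = ∑ z^k / Γ(α k + β)`
(at a pole of `Γ` the convention `1 / 0 = 0` gives the usual value `1 / Γ = 0`). -/
def mittagLeffler {𝕜 : Type*} [RCLike 𝕜] (α β : ℝ) (z : 𝕜) : 𝕜 :=
  ∑' k : ℕ, z ^ k / ((Real.Gamma (α * k + β) : ℝ) : 𝕜)

/-- Riemann-Liouville fractional integral of order `α ≥ 0` with starting point `0`;
the integral of order `0` is the identity. -/
def rlIntegral {𝕜 : Type*} [RCLike 𝕜] (α : ℝ) (g : ℝ → 𝕜) (t : ℝ) : 𝕜 :=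
  if α = 0 then g t
  else (1 / Real.Gamma α) • ∫ τ in (0 : ℝ)..t, (t - τ) ^ (α - 1) • g τ

/-- Hilfer's bi-ordinal fractional derivative of orders `α, β ∈ (n - 1, n]` and type `μ`:
`I^{μ(n-α)} (d/dt)^n I^{(1-μ)(n-β)} g`. -/
def hilferDeriv {𝕜 : Type*} [RCLike 𝕜] (n : ℕ) (α β μ : ℝ) (g : ℝ → 𝕜) : ℝ → 𝕜 :=
  rlIntegral (μ * (n - α)) (iteratedDeriv n (rlIntegral ((1 - μ) * (n - β)) g))

/-- `u` solves, on `(0, ∞)`, the equation `D^{(γ,β)μ} u + lam u = f` with initial values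
`ξ₀, ξ₁` for `I^{(1-μ)(2-β)} u` and its derivative at `0+`. The first four fields
are the regularity under which all terms of the equation are classically defined. -/
structure IsHilferCauchySolution {𝕜 : Type*} [RCLike 𝕜] (γ β μ : ℝ) (lam ξ₀ ξ₁ : 𝕜)
    (f u : ℝ → 𝕜) : Prop where
  continuousOn : ContinuousOn u (Ioi 0)
  integrableOn : ∀ T : ℝ, 0 < T → IntegrableOn u (Ioc 0 T)
  contDiffOn : ContDiffOn ℝ 2 (rlIntegral ((1 - μ) * (2 - β)) u) (Ioi 0)
  integrableOn_deriv2 : ∀ T : ℝ, 0 < T →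
    IntegrableOn (iteratedDeriv 2 (rlIntegral ((1 - μ) * (2 - β)) u)) (Ioc 0 T)
  equation : ∀ t : ℝ, 0 < t → hilferDeriv 2 γ β μ u t + lam * u t = f t
  initial_zero :
    Tendsto (rlIntegral ((1 - μ) * (2 - β)) u) (𝓝[>] 0) (𝓝 ξ₀)
  initial_one :
    Tendsto (deriv (rlIntegral ((1 - μ) * (2 - β)) u)) (𝓝[>] 0) (𝓝 ξ₁)

/-- The explicit Mittag-Leffler formula, with `δ = β + μ (γ - β)`. -/
def hilferCauchyFormula {𝕜 : Type*} [RCLike 𝕜] (γ β μ : ℝ) (lam ξ₀ ξ₁ : 𝕜)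
    (f : ℝ → 𝕜) (t : ℝ) : 𝕜 :=
  let δ : ℝ := β + μ * (γ - β)
  ξ₀ * ((t ^ ((β - 2) * (1 - μ)) : ℝ) : 𝕜)
      * mittagLeffler δ (δ + μ * (2 - γ) - 1) (-lam * ((t ^ δ : ℝ) : 𝕜))
    + ξ₁ * ((t ^ (μ + (β - 1) * (1 - μ)) : ℝ) : 𝕜)
      * mittagLeffler δ (δ + μ * (2 - γ)) (-lam * ((t ^ δ : ℝ) : 𝕜))
    + ∫ τ in (0 : ℝ)..t, (((t - τ) ^ (δ - 1) : ℝ) : 𝕜)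
      * mittagLeffler δ δ (-lam * (((t - τ) ^ δ : ℝ) : 𝕜)) * f τ

end

/-!
Write `a = (1 - μ)(2 - β)`, `b = μ(2 - γ)` and `δ = β + μ(γ - β)`, so that `a + b + δ = 2`.
If `u` is a solution and `w` is the second derivative of `I^a u`, Taylor's formula reads
`I^a u = ξ₀ + ξ₁ t + I^2 w`, where `I^b w = f - λ u`. Cancelling `I^a`, which is injective by Abel's
argument, turns the problem into the Volterra equation
`u + λ I^δ u = ξ₀ t^(-a) / Γ(1 - a) + ξ₁ t^(1 - a) / Γ(2 - a) + I^δ f`.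
As `δ ≥ 1`, its only solution is the Neumann series `∑ (-λ)^k I^(kδ)` of the right-hand side, and
`I^(kδ)` raises exponents by `kδ`, so that this series is the Mittag-Leffler formula.

Conversely, the solution of the Volterra equation solves the problem exactly when `f - λ u` is of
the form `I^b w`, and this amounts to `f = I^b φ` for some `φ`, because `u` itself is in the range
of `I^b`. If `t^(1 - b) f'` is integrable at `0`, then so is `t^(-b) f`, and
`φ = t⁻¹ I^(1 - b) ((1 - b) f + t f')` is a preimage: it is the derivative of `I^(1 - b) f`, and
it is integrable at `0` because `t⁻¹ I^(1 - b)` acts on `t^(-b) f` and `t^(1 - b) f'` through a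
kernel homogeneous of degree `-1`.
-/

/-- Functions on the half-line that are continuous on `(0, ∞)` and integrable near `0`; every
fractional integral of order `α ≥ 0` maps this class to itself. -/
structure ContIntegrable {E : Type*} [NormedAddCommGroup E] (g : ℝ → E) : Prop where
  continuousOn : ContinuousOn g (Ioi 0)
  integrableOn : ∀ T : ℝ, 0 < T → IntegrableOn g (Ioc 0 T)

/-- The kernel `t ^ (α - 1) / Γ(α)` of the Riemann-Liouville integral of order `α`. -/
noncomputable def rlKernel (α t : ℝ) : ℝ := t ^ (α - 1) / Real.Gamma α

section Kernel

variable {α c : ℝ}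

theorem rlKernel_one (t : ℝ) : rlKernel 1 t = 1 := by
  simp [rlKernel]

theorem rlKernel_nonneg (hα : 0 < α) {t : ℝ} (ht : 0 ≤ t) : 0 ≤ rlKernel α t :=
  div_nonneg (Real.rpow_nonneg ht _) (Real.Gamma_pos_of_pos hα).le

theorem monotoneOn_rlKernel (hα : 1 ≤ α) : MonotoneOn (rlKernel α) (Ici 0) :=
  fun s hs _ _ hst => div_le_div_of_nonneg_right
    (Real.rpow_le_rpow hs hst (sub_nonneg.2 hα)) (Real.Gamma_pos_of_pos (by linarith)).le

theorem continuousOn_rlKernel (α : ℝ) : ContinuousOn (rlKernel α) (Ioi 0) :=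
  (continuousOn_id.rpow_const fun _ ht => Or.inl (ne_of_gt ht)).div_const _

theorem intervalIntegrable_rlKernel (hα : 0 < α) (a b : ℝ) :
    IntervalIntegrable (rlKernel α) volume a b :=
  (intervalIntegral.intervalIntegrable_rpow' (by linarith)).div_const _

theorem contIntegrable_rlKernel (hα : 0 < α) : ContIntegrable (rlKernel α) :=
  ⟨continuousOn_rlKernel α, fun _ hT =>
    (intervalIntegrable_iff_integrableOn_Ioc_of_le hT.le).1 (intervalIntegrable_rlKernel hα _ _)⟩

theorem intervalIntegral_rpow_mul_sub_rpow (hα : 0 < α) (hc : 0 < c) {t : ℝ} (ht : 0 < t) :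
    ∫ τ in (0 : ℝ)..t, τ ^ (c - 1) * (t - τ) ^ (α - 1)
      = t ^ (c + α - 1) * (Real.Gamma c * Real.Gamma α / Real.Gamma (c + α)) := by
  have hbeta := Complex.betaIntegral_scaled (c : ℂ) (α : ℂ) ht
  rw [Complex.betaIntegral_eq_Gamma_mul_div _ _ (by simpa) (by simpa)] at hbeta
  apply Complex.ofReal_injective
  rw [← intervalIntegral.integral_ofReal]
  have hcast : ∫ τ in (0 : ℝ)..t, ((τ ^ (c - 1) * (t - τ) ^ (α - 1) : ℝ) : ℂ)
      = ∫ τ in (0 : ℝ)..t, (τ : ℂ) ^ ((c : ℂ) - 1) * ((t : ℂ) - τ) ^ ((α : ℂ) - 1) := by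
    refine intervalIntegral.integral_congr fun τ hτ => ?_
    rw [uIcc_of_le ht.le] at hτ
    rw [Complex.ofReal_mul, Complex.ofReal_cpow hτ.1, Complex.ofReal_cpow (by linarith [hτ.2])]
    push_cast; rfl
  rw [hcast, hbeta, Complex.ofReal_mul, Complex.ofReal_cpow ht.le]
  simp [Complex.Gamma_ofReal, ← Complex.ofReal_add]

theorem intervalIntegral_rlKernel_mul (hα : 0 < α) (hc : 0 < c) {t : ℝ} (ht : 0 < t) :
    ∫ τ in (0 : ℝ)..t, rlKernel α (t - τ) * rlKernel c τ = rlKernel (c + α) t := by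
  have hΓα := (Real.Gamma_pos_of_pos hα).ne'
  have hΓc := (Real.Gamma_pos_of_pos hc).ne'
  calc ∫ τ in (0 : ℝ)..t, rlKernel α (t - τ) * rlKernel c τ
      = ∫ τ in (0 : ℝ)..t,
          (Real.Gamma c * Real.Gamma α)⁻¹ * (τ ^ (c - 1) * (t - τ) ^ (α - 1)) := by
        congr 1; ext τ; unfold rlKernel; field_simp
    _ = rlKernel (c + α) t := by
        rw [intervalIntegral.integral_const_mul, intervalIntegral_rpow_mul_sub_rpow hα hc ht,
          rlKernel]
        field_simp

end Kernel

namespace ContIntegrable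

variable {E : Type*} [NormedAddCommGroup E] {g h : ℝ → E}

theorem congr (hg : ContIntegrable g) (e : EqOn g h (Ioi 0)) : ContIntegrable h :=
  ⟨hg.continuousOn.congr e.symm, fun T hT =>
    (hg.integrableOn T hT).congr_fun (fun _ ht => e ht.1) measurableSet_Ioc⟩

theorem of_integrableOn_one (hg : ContinuousOn g (Ioi 0)) (h1 : IntegrableOn g (Ioc 0 1)) :
    ContIntegrable g := by
  refine ⟨hg, fun T _ => (h1.union (t := Icc 1 T) ?_).mono_set fun t ht => ?_⟩
  · exact (hg.mono fun t ht => one_pos.trans_le ht.1).integrableOn_Icc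
  · exact (le_total t 1).imp (fun h => ⟨ht.1, h⟩) fun h => ⟨h, ht.2⟩

theorem add (hg : ContIntegrable g) (hh : ContIntegrable h) :
    ContIntegrable fun t => g t + h t :=
  ⟨hg.continuousOn.add hh.continuousOn, fun T hT =>
    (hg.integrableOn T hT).add (hh.integrableOn T hT)⟩

theorem sub (hg : ContIntegrable g) (hh : ContIntegrable h) :
    ContIntegrable fun t => g t - h t :=
  ⟨hg.continuousOn.sub hh.continuousOn, fun T hT =>
    (hg.integrableOn T hT).sub (hh.integrableOn T hT)⟩

theorem norm (hg : ContIntegrable g) : ContIntegrable fun t => ‖g t‖ :=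
  ⟨hg.continuousOn.norm, fun T hT => (hg.integrableOn T hT).norm⟩

theorem const_mul {𝕜 : Type*} [RCLike 𝕜] {g : ℝ → 𝕜} (hg : ContIntegrable g) (c : 𝕜) :
    ContIntegrable fun t => c * g t :=
  ⟨continuousOn_const.mul hg.continuousOn, fun T hT => (hg.integrableOn T hT).const_mul c⟩

theorem ofReal {𝕜 : Type*} [RCLike 𝕜] {g : ℝ → ℝ} (hg : ContIntegrable g) :
    ContIntegrable fun t => (g t : 𝕜) :=
  ⟨RCLike.continuous_ofReal.comp_continuousOn hg.continuousOn, fun T hT =>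
    (hg.integrableOn T hT).ofReal⟩

theorem continuousOn_smul [NormedSpace ℝ E] (hg : ContIntegrable g) {k : ℝ → ℝ}
    (hk : ContinuousOn k (Ici 0)) : ContIntegrable fun t => k t • g t := by
  refine ⟨(hk.mono Ioi_subset_Ici_self).smul hg.continuousOn, fun T hT => ?_⟩
  have hgT := hg.integrableOn T hT
  rw [← integrableOn_Icc_iff_integrableOn_Ioc] at hgT ⊢
  exact hgT.continuousOn_smul (hk.mono Icc_subset_Ici_self) isCompact_Icc

theorem intervalIntegrable (hg : ContIntegrable g) {s t : ℝ} (hs : 0 ≤ s) (ht : 0 ≤ t) :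
    IntervalIntegrable g volume s t := by
  have from_zero {T : ℝ} (hT : 0 ≤ T) : IntervalIntegrable g volume 0 T := by
    rcases hT.eq_or_lt with rfl | hT
    · exact IntervalIntegrable.refl
    · exact (intervalIntegrable_iff_integrableOn_Ioc_of_le hT.le).2 (hg.integrableOn T hT)
  exact (from_zero hs).symm.trans (from_zero ht)

theorem intervalIntegrable_rlKernel_smul [NormedSpace ℝ E] (hg : ContIntegrable g) {α t : ℝ}
    (hα : 0 < α) (ht : 0 < t) :
    IntervalIntegrable (fun τ => rlKernel α (t - τ) • g τ) volume 0 t := by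
  have ht2 : t / 2 < t := by linarith
  refine IntervalIntegrable.trans (b := t / 2) ?_ ?_
  · refine (hg.intervalIntegrable le_rfl (by linarith)).continuousOn_smul ?_
    refine (continuousOn_rlKernel α).comp (by fun_prop) fun τ hτ => ?_
    rw [uIcc_of_le (by linarith)] at hτ
    exact sub_pos.2 (hτ.2.trans_lt ht2)
  · have hk := (intervalIntegrable_rlKernel hα (t - t / 2) (t - t)).comp_sub_left t
    simp only [sub_sub_cancel] at hk
    refine hk.smul_continuousOn (hg.continuousOn.mono fun τ hτ => ?_)
    rw [uIcc_of_le ht2.le] at hτ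
    exact (by linarith : 0 < t / 2).trans_le hτ.1

end ContIntegrable

section FractionalIntegral

variable {𝕜 : Type*} [RCLike 𝕜] {g h : ℝ → 𝕜} {α t : ℝ}

theorem rlIntegral_zero (g : ℝ → 𝕜) : rlIntegral 0 g = g := by
  ext t; simp [rlIntegral]

theorem rlIntegral_of_pos (hα : 0 < α) (g : ℝ → 𝕜) (t : ℝ) :
    rlIntegral α g t = ∫ τ in (0 : ℝ)..t, rlKernel α (t - τ) • g τ := by
  rw [rlIntegral, if_neg hα.ne', ← intervalIntegral.integral_smul]
  congr 1; ext τ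
  rw [smul_smul, rlKernel, one_div_mul_eq_div]

theorem rlIntegral_one (g : ℝ → 𝕜) : rlIntegral 1 g = fun t => ∫ τ in (0 : ℝ)..t, g τ := by
  ext t; simp [rlIntegral]

theorem rlIntegral_congr (hα : 0 ≤ α) (ht : 0 < t) (e : EqOn g h (Ioi 0)) :
    rlIntegral α g t = rlIntegral α h t := by
  rcases hα.eq_or_lt with rfl | hα
  · simpa only [rlIntegral_zero] using e ht
  · rw [rlIntegral_of_pos hα, rlIntegral_of_pos hα]
    exact intervalIntegral.integral_congr_Ioo_of_le ht.le fun τ hτ =>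
      congrArg (rlKernel α (t - τ) • ·) (e hτ.1)

theorem rlIntegral_const_mul (α : ℝ) (c : 𝕜) (g : ℝ → 𝕜) (t : ℝ) :
    rlIntegral α (fun τ => c * g τ) t = c * rlIntegral α g t := by
  unfold rlIntegral
  split_ifs
  · rfl
  · simp only [← mul_smul_comm, intervalIntegral.integral_const_mul]

theorem rlIntegral_add (hα : 0 ≤ α) (ht : 0 < t) (hg : ContIntegrable g)
    (hh : ContIntegrable h) :
    rlIntegral α (fun τ => g τ + h τ) t = rlIntegral α g t + rlIntegral α h t := by
  rcases hα.eq_or_lt with rfl | hα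
  · simp only [rlIntegral_zero]
  · simp only [rlIntegral_of_pos hα, smul_add]
    exact intervalIntegral.integral_add (hg.intervalIntegrable_rlKernel_smul hα ht)
      (hh.intervalIntegrable_rlKernel_smul hα ht)

theorem rlIntegral_sub (hα : 0 ≤ α) (ht : 0 < t) (hg : ContIntegrable g)
    (hh : ContIntegrable h) :
    rlIntegral α (fun τ => g τ - h τ) t = rlIntegral α g t - rlIntegral α h t := by
  have hadd := rlIntegral_add hα ht hg (hh.const_mul (-1))
  rw [rlIntegral_const_mul] at hadd
  simpa only [sub_eq_add_neg, neg_one_mul] using hadd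

theorem rlIntegral_rlKernel {c : ℝ} (hα : 0 ≤ α) (hc : 0 < c) (ht : 0 < t) :
    rlIntegral α (fun τ => (rlKernel c τ : 𝕜)) t = rlKernel (c + α) t := by
  rcases hα.eq_or_lt with rfl | hα
  · simp only [rlIntegral_zero, add_zero]
  · simp only [rlIntegral_of_pos hα, RCLike.real_smul_eq_coe_mul, ← RCLike.ofReal_mul]
    rw [intervalIntegral.integral_of_le ht.le, integral_ofReal,
      ← intervalIntegral.integral_of_le ht.le, intervalIntegral_rlKernel_mul hα hc ht]

theorem rlIntegral_mono {g h : ℝ → ℝ} (hα : 0 ≤ α) (ht : 0 < t) (hg : ContIntegrable g)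
    (hh : ContIntegrable h) (hgh : ∀ τ, 0 < τ → g τ ≤ h τ) :
    rlIntegral α g t ≤ rlIntegral α h t := by
  rcases hα.eq_or_lt with rfl | hα
  · simpa only [rlIntegral_zero] using hgh t ht
  · rw [rlIntegral_of_pos hα, rlIntegral_of_pos hα]
    refine intervalIntegral.integral_mono_on_of_le_Ioo ht.le
      (hg.intervalIntegrable_rlKernel_smul hα ht) (hh.intervalIntegrable_rlKernel_smul hα ht)
      fun τ hτ => ?_
    exact smul_le_smul_of_nonneg_left (hgh τ hτ.1) (rlKernel_nonneg hα (sub_nonneg.2 hτ.2.le))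

theorem norm_rlIntegral_le (hα : 0 ≤ α) (ht : 0 < t) (g : ℝ → 𝕜) :
    ‖rlIntegral α g t‖ ≤ rlIntegral α (fun τ => ‖g τ‖) t := by
  rcases hα.eq_or_lt with rfl | hα
  · simp only [rlIntegral_zero, le_refl]
  rw [rlIntegral_of_pos hα, rlIntegral_of_pos hα]
  refine (intervalIntegral.norm_integral_le_integral_norm ht.le).trans_eq ?_
  refine intervalIntegral.integral_congr_Ioo_of_le ht.le fun τ hτ => ?_
  rw [norm_smul, Real.norm_of_nonneg (rlKernel_nonneg hα (sub_nonneg.2 hτ.2.le)), smul_eq_mul]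

theorem norm_rlIntegral_le_of_one_le {T : ℝ} (hα : 1 ≤ α) (ht : 0 < t) (htT : t ≤ T)
    (hg : ContIntegrable g) :
    ‖rlIntegral α g t‖ ≤ rlKernel α T * ∫ τ in (0 : ℝ)..T, ‖g τ‖ := by
  have hα0 : 0 < α := one_pos.trans_le hα
  have hT : 0 ≤ T := ht.le.trans htT
  calc ‖rlIntegral α g t‖ ≤ ∫ τ in (0 : ℝ)..t, rlKernel α (t - τ) • ‖g τ‖ :=
        (norm_rlIntegral_le hα0.le ht g).trans_eq (rlIntegral_of_pos hα0 _ t)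
    _ ≤ ∫ τ in (0 : ℝ)..t, rlKernel α T * ‖g τ‖ := by
        refine intervalIntegral.integral_mono_on ht.le
          (hg.norm.intervalIntegrable_rlKernel_smul hα0 ht)
          ((hg.norm.intervalIntegrable le_rfl ht.le).const_mul _) fun τ hτ => ?_
        have hk : rlKernel α (t - τ) ≤ rlKernel α T :=
          monotoneOn_rlKernel hα (sub_nonneg.2 hτ.2) hT (by linarith [hτ.1])
        exact mul_le_mul_of_nonneg_right hk (norm_nonneg _)
    _ = rlKernel α T * ∫ τ in (0 : ℝ)..t, ‖g τ‖ := intervalIntegral.integral_const_mul _ _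
    _ ≤ rlKernel α T * ∫ τ in (0 : ℝ)..T, ‖g τ‖ := by
        refine mul_le_mul_of_nonneg_left ?_ (rlKernel_nonneg hα0 hT)
        exact intervalIntegral.integral_mono_interval le_rfl ht.le htT
          (Eventually.of_forall fun _ => norm_nonneg _) (hg.norm.intervalIntegrable le_rfl hT)

end FractionalIntegral

section Continuity

variable {E : Type*} [NormedAddCommGroup E] [NormedSpace ℝ E] {k : ℝ → ℝ} {g : ℝ → E}

theorem continuous_intervalIntegral_comp_sub_smul (hk : ∀ a b, IntervalIntegrable k volume a b)
    (hg : Continuous g) (c : ℝ) : Continuous fun t => ∫ τ in c..t, k (t - τ) • g τ := by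
  have hsubst : (fun t => ∫ τ in c..t, k (t - τ) • g τ)
      = fun t => ∫ s in (0 : ℝ)..(t - c), k s • g (t - s) := by
    ext t
    simpa using intervalIntegral.integral_comp_sub_left (a := c) (b := t)
      (fun s => k s • g (t - s)) t
  rw [hsubst, continuous_iff_continuousAt]
  intro t₀
  set M := |t₀ - c| + 1
  obtain ⟨C, hC⟩ := (isCompact_Icc (a := t₀ - 1 - M) (b := t₀ + 1 + M)).exists_bound_of_continuousOn
    hg.continuousOn
  have hprim := intervalIntegral.continuousAt_parametric_primitive_of_dominated (μ := volume)
    (F := fun t s => k s • g (t - s)) (fun s => ‖k s‖ * C) (-M) M (a₀ := 0) (b₀ := t₀ - c)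
    (x₀ := t₀) ?meas ?bound ((hk _ _).norm.mul_const _) ?cont
    ⟨by grind, by positivity⟩ ⟨by grind, by grind⟩ (by simp)
  case meas =>
    exact fun t => (hk _ _).def'.aestronglyMeasurable.smul
      (by fun_prop : Continuous fun s => g (t - s)).aestronglyMeasurable
  case bound =>
    filter_upwards [Ioo_mem_nhds (sub_one_lt t₀) (lt_add_one t₀)] with t ht
    refine (ae_restrict_mem measurableSet_uIoc).mono fun s hs => ?_
    rw [uIoc_of_le (by grind)] at hs
    rw [norm_smul]
    gcongr
    exact hC _ ⟨by linarith [ht.1, hs.2], by linarith [ht.2, hs.1]⟩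
  case cont =>
    exact Eventually.of_forall fun s => by fun_prop
  exact hprim.comp (f := fun t : ℝ => (t, t - c)) (by fun_prop)

theorem continuousAt_intervalIntegral_comp_sub_smul (hk : ContinuousOn k (Ioi 0)) {a c t₀ : ℝ}
    (hac : a ≤ c) (hc : c < t₀) (hg : IntervalIntegrable g volume a c) :
    ContinuousAt (fun t => ∫ τ in a..c, k (t - τ) • g τ) t₀ := by
  obtain ⟨C, hC⟩ := (isCompact_Icc (a := (t₀ - c) / 2)
    (b := t₀ + 1 - a)).exists_bound_of_continuousOn
    (hk.mono fun x hx => (by linarith : 0 < (t₀ - c) / 2).trans_le hx.1)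
  have hnear : ∀ᶠ t in 𝓝 t₀, t ∈ Ioo ((t₀ + c) / 2) (t₀ + 1) :=
    Ioo_mem_nhds (by linarith) (by linarith)
  refine intervalIntegral.continuousAt_of_dominated_interval (bound := fun τ => C * ‖g τ‖)
    ?meas ?bound (hg.norm.const_mul _) ?cont
  case meas =>
    filter_upwards [hnear] with t ht
    refine ContinuousOn.aestronglyMeasurable ?_ measurableSet_uIoc |>.smul
      hg.def'.aestronglyMeasurable
    refine hk.comp (by fun_prop) fun τ hτ => ?_
    rw [uIoc_of_le hac] at hτ
    exact mem_Ioi.2 (by linarith [ht.1, hτ.2])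
  case bound =>
    filter_upwards [hnear] with t ht
    refine Eventually.of_forall fun τ hτ => ?_
    rw [uIoc_of_le hac] at hτ
    rw [norm_smul]
    gcongr
    exact hC _ ⟨by linarith [ht.1, hτ.2], by linarith [ht.2, hτ.1]⟩
  case cont =>
    refine Eventually.of_forall fun τ hτ => ContinuousAt.smul ?_ continuousAt_const
    rw [uIoc_of_le hac] at hτ
    exact (hk.continuousAt (Ioi_mem_nhds (sub_pos.2 (hτ.2.trans_lt hc)))).comp'
      (f := fun t => t - τ) (by fun_prop)

end Continuity

section Convolution

open scoped Convolution
open ContinuousLinearMap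

variable {𝕜 : Type*} [RCLike 𝕜] {g : ℝ → 𝕜} {α β t : ℝ}

theorem indicator_rlIntegral_eq_convolution (hα : 0 < α) (g : ℝ → 𝕜) :
    indicator (Ioi 0) (rlIntegral α g) =
      indicator (Ioi 0) g ⋆[(lsmul ℝ ℝ).flip, volume] indicator (Ioi 0) (rlKernel α) := by
  rw [← posConvolution_eq_convolution_indicator _ _ _ volume, posConvolution]
  simp only [funext (rlIntegral_of_pos hα g), flip_apply, lsmul_apply]

theorem indicator_rlKernel_convolution (hα : 0 < α) (hβ : 0 < β) :
    indicator (Ioi 0) (rlKernel α) ⋆[mul ℝ ℝ, volume] indicator (Ioi 0) (rlKernel β)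
      = indicator (Ioi 0) (rlKernel (α + β)) := by
  rw [← posConvolution_eq_convolution_indicator _ _ _ volume, posConvolution]
  refine indicator_congr fun t ht => ?_
  simpa only [mul_apply', mul_comm] using intervalIntegral_rlKernel_mul hβ hα ht

theorem ContIntegrable.convolutionExistsAt_norm (hg : ContIntegrable g) (hα : 0 < α) (t : ℝ) :
    ConvolutionExistsAt (fun τ => ‖indicator (Ioi 0) g τ‖)
      (fun τ => ‖indicator (Ioi 0) (rlKernel α) τ‖) t (mul ℝ ℝ) volume := by
  have hsupp : (fun τ => ‖indicator (Ioi 0) g τ‖ * ‖indicator (Ioi 0) (rlKernel α) (t - τ)‖)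
      = indicator (Ioo 0 t) fun τ => ‖rlKernel α (t - τ) • g τ‖ := by
    ext τ
    by_cases h0 : 0 < τ <;> by_cases ht : τ < t <;> simp [indicator, h0, ht, norm_smul, mul_comm]
  rw [ConvolutionExistsAt]
  simp only [mul_apply']
  rw [hsupp, integrable_indicator_iff measurableSet_Ioo]
  rcases le_or_gt t 0 with ht | ht
  · simp [Ioo_eq_empty_of_le ht]
  · exact ((intervalIntegrable_iff_integrableOn_Ioo_of_le ht.le).1
      (hg.intervalIntegrable_rlKernel_smul hα ht)).norm

theorem ContIntegrable.aestronglyMeasurable_indicator (hg : ContIntegrable g) :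
    AEStronglyMeasurable (indicator (Ioi 0) g) :=
  (aestronglyMeasurable_indicator_iff measurableSet_Ioi).2
    (hg.continuousOn.aestronglyMeasurable measurableSet_Ioi)

theorem ContIntegrable.convolutionExistsAt (hg : ContIntegrable g) (hα : 0 < α) (t : ℝ) :
    ConvolutionExistsAt (indicator (Ioi 0) g) (indicator (Ioi 0) (rlKernel α)) t
      (lsmul ℝ ℝ).flip volume :=
  (hg.convolutionExistsAt_norm hα t).of_norm _ hg.aestronglyMeasurable_indicator
    (contIntegrable_rlKernel hα).aestronglyMeasurable_indicator

theorem ContIntegrable.continuousOn_rlIntegral (hg : ContIntegrable g) (hα : 0 < α) :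
    ContinuousOn (rlIntegral α g) (Ioi 0) := by
  intro t₀ (ht₀ : 0 < t₀)
  refine ContinuousAt.continuousWithinAt ?_
  obtain ⟨c, hc0, hc⟩ := exists_between ht₀
  have hcut : Continuous fun τ => g (max τ c) :=
    hg.continuousOn.comp_continuous (by fun_prop) fun τ => hc0.trans_le (le_max_right _ _)
  have hsplit : ∀ᶠ t in 𝓝 t₀, (∫ τ in (0 : ℝ)..c, rlKernel α (t - τ) • g τ)
      + (∫ τ in c..t, rlKernel α (t - τ) • g (max τ c)) = rlIntegral α g t := by
    filter_upwards [Ioi_mem_nhds hc] with t (ht : c < t)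
    have hint := hg.intervalIntegrable_rlKernel_smul hα (hc0.trans ht)
    rw [rlIntegral_of_pos hα, ← intervalIntegral.integral_add_adjacent_intervals
      (hint.mono_set (uIcc_subset_uIcc_left (mem_uIcc.2 (Or.inl ⟨hc0.le, ht.le⟩))))
      (hint.mono_set (uIcc_subset_uIcc_right (mem_uIcc.2 (Or.inl ⟨hc0.le, ht.le⟩))))]
    congr 1
    exact intervalIntegral.integral_congr_Ioo_of_le ht.le fun τ hτ => by
      simp only [max_eq_left hτ.1.le]
  exact ((continuousAt_intervalIntegral_comp_sub_smul (continuousOn_rlKernel α) hc0.le hc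
    (hg.intervalIntegrable le_rfl hc0.le)).add (continuous_intervalIntegral_comp_sub_smul
      (intervalIntegrable_rlKernel hα) hcut c).continuousAt).congr hsplit

theorem ContIntegrable.integrableOn_rlIntegral (hg : ContIntegrable g) (hα : 0 < α) {T : ℝ}
    (hT : 0 < T) : IntegrableOn (rlIntegral α g) (Ioc 0 T) := by
  have hconv := integrable_posConvolution
    (((integrable_indicator_iff measurableSet_Ioc).2 (hg.integrableOn T hT)).integrableOn)
    (((integrable_indicator_iff measurableSet_Ioc).2
      ((contIntegrable_rlKernel hα).integrableOn T hT)).integrableOn)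
    ((lsmul ℝ ℝ).flip : 𝕜 →L[ℝ] ℝ →L[ℝ] 𝕜)
  refine hconv.integrableOn.congr_fun (fun t ht => ?_) measurableSet_Ioc
  rw [posConvolution, indicator_of_mem (mem_Ioi.2 ht.1), rlIntegral_of_pos hα]
  refine intervalIntegral.integral_congr_Ioo_of_le ht.1.le fun τ hτ => ?_
  have hτT : τ ∈ Ioc 0 T := ⟨hτ.1, hτ.2.le.trans ht.2⟩
  have htT : t - τ ∈ Ioc 0 T := ⟨sub_pos.2 hτ.2, by linarith [hτ.1, ht.2]⟩
  simp only [indicator_of_mem hτT, indicator_of_mem htT, flip_apply, lsmul_apply]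

protected theorem ContIntegrable.rlIntegral (hg : ContIntegrable g) (hα : 0 ≤ α) :
    ContIntegrable (rlIntegral α g) := by
  rcases hα.eq_or_lt with rfl | hα
  · rwa [rlIntegral_zero]
  · exact ⟨hg.continuousOn_rlIntegral hα, fun _ => hg.integrableOn_rlIntegral hα⟩

theorem ContIntegrable.rlIntegral_rlIntegral (hg : ContIntegrable g) (hα : 0 ≤ α) (hβ : 0 ≤ β)
    (ht : 0 < t) : rlIntegral α (rlIntegral β g) t = rlIntegral (α + β) g t := by
  rcases hα.eq_or_lt with rfl | hα
  · rw [rlIntegral_zero, zero_add]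
  rcases hβ.eq_or_lt with rfl | hβ
  · rw [rlIntegral_zero, add_zero]
  have hassoc := convolution_assoc (𝕜 := ℝ) (x₀ := t) (f := indicator (Ioi 0) g)
    (lsmul ℝ ℝ).flip (lsmul ℝ ℝ).flip (lsmul ℝ ℝ).flip (mul ℝ ℝ)
    (fun x y z => by simp only [flip_apply, lsmul_apply, mul_apply', smul_smul, mul_comm])
    hg.aestronglyMeasurable_indicator
    (contIntegrable_rlKernel hβ).aestronglyMeasurable_indicator
    (contIntegrable_rlKernel hα).aestronglyMeasurable_indicator
    (ae_of_all _ fun x => hg.convolutionExistsAt hβ x)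
    (ae_of_all _ fun x => (contIntegrable_rlKernel hβ).convolutionExistsAt_norm hα x) ?_
  · rw [← indicator_rlIntegral_eq_convolution hβ, ← indicator_rlIntegral_eq_convolution hα,
      indicator_rlKernel_convolution hβ hα,
      ← indicator_rlIntegral_eq_convolution (add_pos hβ hα)] at hassoc
    rwa [indicator_of_mem (mem_Ioi.2 ht), indicator_of_mem (mem_Ioi.2 ht), add_comm β α] at hassoc
  · have hnorm {γ : ℝ} (hγ : 0 < γ) : (fun τ => ‖indicator (Ioi 0) (rlKernel γ) τ‖)
        = indicator (Ioi 0) (rlKernel γ) := by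
      ext τ
      exact Real.norm_of_nonneg (indicator_nonneg (fun _ h => rlKernel_nonneg hγ (le_of_lt h)) τ)
    rw [hnorm hα, hnorm hβ, indicator_rlKernel_convolution hβ hα, ← hnorm (add_pos hβ hα)]
    exact hg.convolutionExistsAt_norm (add_pos hβ hα) t

end Convolution

section Abel

variable {𝕜 : Type*} [RCLike 𝕜] {g h p : ℝ → 𝕜} {α t : ℝ}

theorem ContIntegrable.hasDerivAt_rlIntegral_one (hg : ContIntegrable g) (ht : 0 < t) :
    HasDerivAt (rlIntegral 1 g) (g t) t := by
  rw [rlIntegral_one]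
  exact intervalIntegral.integral_hasDerivAt_right (hg.intervalIntegrable le_rfl ht.le)
    (hg.continuousOn.stronglyMeasurableAtFilter isOpen_Ioi t ht)
    (hg.continuousOn.continuousAt (Ioi_mem_nhds ht))

theorem ContIntegrable.tendsto_rlIntegral_one (hg : ContIntegrable g) :
    Tendsto (rlIntegral 1 g) (𝓝[>] 0) (𝓝 0) := by
  have hcont : ContinuousOn (rlIntegral 1 g) (uIcc 0 1) := by
    rw [rlIntegral_one]
    refine intervalIntegral.continuousOn_primitive_interval ?_
    rw [uIcc_of_le zero_le_one, integrableOn_Icc_iff_integrableOn_Ioc]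
    exact hg.integrableOn 1 one_pos
  have hzero : rlIntegral 1 g 0 = 0 := by
    simp only [rlIntegral_one, intervalIntegral.integral_same]
  have hlim := hcont 0 left_mem_uIcc
  rw [ContinuousWithinAt, hzero, uIcc_of_le zero_le_one] at hlim
  exact hlim.mono_left (nhdsWithin_le_iff.2
    (mem_of_superset (Ioc_mem_nhdsGT one_pos) Ioc_subset_Icc_self))

theorem eq_add_rlIntegral_one {L : 𝕜} (hg : ContIntegrable g)
    (hp : ∀ t, 0 < t → HasDerivAt p (g t) t) (hL : Tendsto p (𝓝[>] 0) (𝓝 L)) (ht : 0 < t) :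
    p t = L + rlIntegral 1 g t := by
  simp only [rlIntegral_one]
  rw [intervalIntegral.integral_eq_sub_of_hasDerivAt_of_tendsto ht
    (fun x hx => hp x hx.1) (hg.intervalIntegrable le_rfl ht.le) hL
    ((hp t ht).continuousAt.tendsto.mono_left nhdsWithin_le_nhds), add_sub_cancel]

theorem ContIntegrable.eqOn_of_rlIntegral_one_eqOn (hg : ContIntegrable g) (hh : ContIntegrable h)
    (e : EqOn (rlIntegral 1 g) (rlIntegral 1 h) (Ioi 0)) : EqOn g h (Ioi 0) :=
  fun _ ht => (hg.hasDerivAt_rlIntegral_one ht).unique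
    ((hh.hasDerivAt_rlIntegral_one ht).congr_of_eventuallyEq
      (e.eventuallyEq_of_mem (Ioi_mem_nhds ht)))

-- Abel: `I^(1 - α)` reduces the injectivity of `I^α` to the one of `I^1`.
theorem ContIntegrable.eqOn_of_rlIntegral_eqOn (hg : ContIntegrable g) (hh : ContIntegrable h)
    (hα : 0 ≤ α) (hα1 : α ≤ 1) (e : EqOn (rlIntegral α g) (rlIntegral α h) (Ioi 0)) :
    EqOn g h (Ioi 0) := by
  refine hg.eqOn_of_rlIntegral_one_eqOn hh fun t ht => ?_
  have hα' := sub_nonneg.2 hα1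
  rw [← sub_add_cancel 1 α, ← hg.rlIntegral_rlIntegral hα' hα ht,
    ← hh.rlIntegral_rlIntegral hα' hα ht]
  exact rlIntegral_congr hα' ht e

end Abel

section Series

variable {E : Type*} [NormedAddCommGroup E]

theorem hasSum_intervalIntegral_of_summable_integral_norm [NormedSpace ℝ E] {F : ℕ → ℝ → E}
    {G : ℝ → E} {a b : ℝ} (hab : a ≤ b) (hF : ∀ k, IntervalIntegrable (F k) volume a b)
    (hsum : Summable fun k => ∫ τ in a..b, ‖F k τ‖)
    (hG : ∀ τ ∈ Ioo a b, HasSum (fun k => F k τ) (G τ)) :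
    HasSum (fun k => ∫ τ in a..b, F k τ) (∫ τ in a..b, G τ) := by
  simp only [intervalIntegral.integral_of_le hab, integral_Ioc_eq_integral_Ioo] at hsum ⊢
  rw [setIntegral_congr_fun measurableSet_Ioo fun τ hτ => (hG τ hτ).tsum_eq.symm]
  exact hasSum_integral_of_summable_integral_norm
    (fun k => (intervalIntegrable_iff_integrableOn_Ioo_of_le hab).1 (hF k)) hsum

theorem hasSum_rlIntegral {𝕜 : Type*} [RCLike 𝕜] {F : ℕ → ℝ → 𝕜} {G : ℝ → 𝕜} {α t : ℝ}
    (hα : 0 ≤ α) (ht : 0 < t) (hF : ∀ k, ContIntegrable (F k))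
    (hsum : Summable fun k => rlIntegral α (fun τ => ‖F k τ‖) t)
    (hG : ∀ τ, 0 < τ → HasSum (fun k => F k τ) (G τ)) :
    HasSum (fun k => rlIntegral α (F k) t) (rlIntegral α G t) := by
  rcases hα.eq_or_lt with rfl | hα
  · simpa only [rlIntegral_zero] using hG t ht
  simp only [rlIntegral_of_pos hα] at hsum ⊢
  refine hasSum_intervalIntegral_of_summable_integral_norm ht.le
    (fun k => (hF k).intervalIntegrable_rlKernel_smul hα ht) (hsum.congr fun k => ?_)
    fun τ hτ => (hG τ hτ.1).const_smul _
  refine intervalIntegral.integral_congr_Ioo_of_le ht.le fun τ hτ => ?_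
  simp only [norm_smul, Real.norm_of_nonneg (rlKernel_nonneg hα (sub_nonneg.2 hτ.2.le)),
    smul_eq_mul]

theorem contIntegrable_tsum [CompleteSpace E] {F : ℕ → ℝ → E} {B : ℝ → ℕ → ℝ}
    (hF : ∀ k, ContinuousOn (F k) (Ioi 0)) (hB : ∀ T, 0 < T → Summable (B T))
    (hFB : ∀ T t, 0 < t → t ≤ T → ∀ k, ‖F k t‖ ≤ B T k) :
    ContIntegrable fun t => ∑' k, F k t := by
  have hcont (T : ℝ) (hT : 0 < T) : ContinuousOn (fun t => ∑' k, F k t) (Ioc 0 T) :=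
    continuousOn_tsum (fun k => (hF k).mono Ioc_subset_Ioi_self) (hB T hT)
      fun k t ht => hFB T t ht.1 ht.2 k
  constructor
  · exact fun t (ht : 0 < t) => ((hcont (t + 1) (by linarith)).continuousAt
      (Ioc_mem_nhds ht (lt_add_one t))).continuousWithinAt
  · intro T hT
    refine IntegrableOn.of_bound measure_Ioc_lt_top
      ((hcont T hT).aestronglyMeasurable measurableSet_Ioc) (∑' k, B T k) ?_
    exact (ae_restrict_mem measurableSet_Ioc).mono fun t ht =>
      tsum_of_norm_bounded (hB T hT).hasSum (hFB T t ht.1 ht.2)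

theorem summable_pow_mul_rlKernel {r T δ c : ℝ} (hr : 0 ≤ r) (hT : 0 < T) (hδ : 1 ≤ δ)
    (hc : 0 ≤ c) : Summable fun k : ℕ => r ^ k * rlKernel (c + δ * k) T := by
  rw [← summable_nat_add_iff 2]
  have hs := ((summable_nat_add_iff 1).2
    (Real.summable_pow_div_factorial (r * T ^ δ))).mul_left (r * T ^ δ * T ^ (c - 1))
  have hbig (k : ℕ) : (k : ℝ) + 2 ≤ c + δ * (k + 2 : ℕ) := by
    push_cast
    nlinarith [mul_le_mul_of_nonneg_right hδ (show (0 : ℝ) ≤ (k : ℝ) + 2 by positivity)]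
  have hΓ (k : ℕ) : ((k + 1).factorial : ℝ) ≤ Real.Gamma (c + δ * (k + 2 : ℕ)) := by
    have h2 : (2 : ℝ) ≤ (k : ℝ) + 2 := by linarith [k.cast_nonneg (α := ℝ)]
    have hmono := Real.Gamma_strictMonoOn_Ici.monotoneOn h2 (h2.trans (hbig k)) (hbig k)
    rwa [show (k : ℝ) + 2 = (k + 1 : ℕ) + 1 by push_cast; ring, Real.Gamma_nat_eq_factorial]
      at hmono
  refine Summable.of_nonneg_of_le (fun k => ?_) (fun k => ?_) hs
  · exact mul_nonneg (pow_nonneg hr _)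
      (rlKernel_nonneg (lt_of_lt_of_le (by positivity) (hbig k)) hT.le)
  · have hpow : T ^ (c + δ * (k + 2 : ℕ) - 1) = T ^ (c - 1) * (T ^ δ) ^ (k + 2) := by
      rw [← Real.rpow_natCast, ← Real.rpow_mul hT.le, ← Real.rpow_add hT]
      congr 1; ring
    calc r ^ (k + 2) * rlKernel (c + δ * (k + 2 : ℕ)) T
        ≤ r ^ (k + 2) * (T ^ (c + δ * (k + 2 : ℕ) - 1) / (k + 1).factorial) := by
          unfold rlKernel
          gcongr
          exact hΓ k
      _ = _ := by rw [hpow]; ring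

end Series

/-- The `k`-th term `(-lam) ^ k I^(δ k) g` of the Neumann series of `(1 + lam I^δ)⁻¹`. -/
noncomputable def neumannTerm {𝕜 : Type*} [RCLike 𝕜] (δ : ℝ) (lam : 𝕜) (g : ℝ → 𝕜) (k : ℕ)
    (t : ℝ) : 𝕜 :=
  (-lam) ^ k * rlIntegral (δ * k) g t

/-- The inverse `(1 + lam I^δ)⁻¹ g` of the Volterra operator, as a Neumann series. -/
noncomputable def volterraResolvent {𝕜 : Type*} [RCLike 𝕜] (δ : ℝ) (lam : 𝕜) (g : ℝ → 𝕜)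
    (t : ℝ) : 𝕜 :=
  ∑' k : ℕ, neumannTerm δ lam g k t

section Resolvent

variable {𝕜 : Type*} [RCLike 𝕜] {g h : ℝ → 𝕜} {α δ t : ℝ} {lam : 𝕜}

theorem neumannTerm_zero (g : ℝ → 𝕜) : neumannTerm δ lam g 0 = g := by
  ext t
  simp [neumannTerm, rlIntegral_zero]

protected theorem ContIntegrable.neumannTerm (hg : ContIntegrable g) (hδ : 0 ≤ δ) (k : ℕ) :
    ContIntegrable (neumannTerm δ lam g k) :=
  (hg.rlIntegral (mul_nonneg hδ k.cast_nonneg)).const_mul _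

theorem neumannTerm_congr (hδ : 0 ≤ δ) (ht : 0 < t) (e : EqOn g h (Ioi 0)) (k : ℕ) :
    neumannTerm δ lam g k t = neumannTerm δ lam h k t :=
  congrArg _ (rlIntegral_congr (mul_nonneg hδ k.cast_nonneg) ht e)

theorem neumannTerm_const_mul (c : 𝕜) (g : ℝ → 𝕜) (k : ℕ) (t : ℝ) :
    neumannTerm δ lam (fun τ => c * g τ) k t = c * neumannTerm δ lam g k t := by
  rw [neumannTerm, rlIntegral_const_mul, neumannTerm, mul_left_comm]

theorem neumannTerm_rlKernel {c : ℝ} (hδ : 0 ≤ δ) (hc : 0 < c) (ht : 0 < t) (k : ℕ) :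
    neumannTerm δ lam (fun τ => (rlKernel c τ : 𝕜)) k t
      = (-lam) ^ k * rlKernel (c + δ * k) t := by
  rw [neumannTerm, rlIntegral_rlKernel (mul_nonneg hδ k.cast_nonneg) hc ht]

theorem ContIntegrable.rlIntegral_neumannTerm (hg : ContIntegrable g) (hδ : 0 ≤ δ) (hα : 0 ≤ α)
    (ht : 0 < t) (k : ℕ) :
    rlIntegral α (neumannTerm δ lam g k) t
      = neumannTerm δ lam (rlIntegral α g) k t := by
  have hk : 0 ≤ δ * k := mul_nonneg hδ k.cast_nonneg
  unfold neumannTerm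
  rw [rlIntegral_const_mul, hg.rlIntegral_rlIntegral hα hk ht, hg.rlIntegral_rlIntegral hk hα ht,
    add_comm]

theorem ContIntegrable.neumannTerm_succ (hg : ContIntegrable g) (hδ : 0 ≤ δ) (ht : 0 < t)
    (k : ℕ) :
    neumannTerm δ lam g (k + 1) t
      = -lam * neumannTerm δ lam (rlIntegral δ g) k t := by
  rw [neumannTerm, neumannTerm,
    hg.rlIntegral_rlIntegral (mul_nonneg hδ k.cast_nonneg) hδ ht, pow_succ', mul_assoc]
  push_cast
  rw [mul_add, mul_one]

theorem norm_neumannTerm_le (hδ : 0 ≤ δ) (ht : 0 < t) (g : ℝ → 𝕜) (k : ℕ) :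
    ‖neumannTerm δ lam g k t‖ ≤ neumannTerm δ (-‖lam‖) (fun τ => ‖g τ‖) k t := by
  rw [neumannTerm, neumannTerm, norm_mul, norm_pow, norm_neg, neg_neg]
  exact mul_le_mul_of_nonneg_left (norm_rlIntegral_le (mul_nonneg hδ k.cast_nonneg) ht g)
    (pow_nonneg (norm_nonneg _) _)

theorem ContIntegrable.norm_neumannTerm_succ_le (hg : ContIntegrable g) (hδ : 1 ≤ δ) {T : ℝ}
    (ht : 0 < t) (htT : t ≤ T) (k : ℕ) :
    ‖neumannTerm δ lam g (k + 1) t‖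
      ≤ ‖lam‖ ^ (k + 1) * rlKernel (δ * (k + 1 : ℕ)) T * ∫ τ in (0 : ℝ)..T, ‖g τ‖ := by
  have hk : 1 ≤ δ * (k + 1 : ℕ) := by
    push_cast
    nlinarith [mul_nonneg (zero_le_one.trans hδ) (k.cast_nonneg (α := ℝ))]
  rw [neumannTerm, norm_mul, norm_pow, norm_neg, mul_assoc]
  exact mul_le_mul_of_nonneg_left (norm_rlIntegral_le_of_one_le hk ht htT hg)
    (pow_nonneg (norm_nonneg _) _)

theorem summable_neumannTerm_bound (hδ : 1 ≤ δ) (lam : 𝕜) (g : ℝ → 𝕜) {T : ℝ} (hT : 0 < T) :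
    Summable fun k : ℕ =>
      ‖lam‖ ^ (k + 1) * rlKernel (δ * (k + 1 : ℕ)) T * ∫ τ in (0 : ℝ)..T, ‖g τ‖ := by
  have hsum := summable_pow_mul_rlKernel (norm_nonneg lam) hT hδ le_rfl
  simp only [zero_add] at hsum
  exact ((summable_nat_add_iff 1).2 hsum).mul_right _

theorem ContIntegrable.summable_neumannTerm (hg : ContIntegrable g) (hδ : 1 ≤ δ) (ht : 0 < t) :
    Summable fun k => neumannTerm δ lam g k t :=
  (summable_nat_add_iff 1).1 (Summable.of_norm_bounded (summable_neumannTerm_bound hδ lam g ht)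
    fun k => hg.norm_neumannTerm_succ_le hδ ht le_rfl k)

protected theorem ContIntegrable.volterraResolvent (hg : ContIntegrable g) (hδ : 1 ≤ δ) :
    ContIntegrable (volterraResolvent δ lam g) := by
  have htail : ContIntegrable fun t => ∑' k, neumannTerm δ lam g (k + 1) t :=
    contIntegrable_tsum (fun k => (hg.neumannTerm (zero_le_one.trans hδ) (k + 1)).continuousOn)
      (fun _ => summable_neumannTerm_bound hδ lam g)
      fun _ _ ht htT => hg.norm_neumannTerm_succ_le hδ ht htT
  refine (hg.add htail).congr fun t ht => ?_
  rw [volterraResolvent, (hg.summable_neumannTerm hδ ht).tsum_eq_zero_add,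
    neumannTerm_zero]

theorem ContIntegrable.rlIntegral_volterraResolvent (hg : ContIntegrable g) (hδ : 1 ≤ δ)
    (hα : 0 ≤ α) (ht : 0 < t) :
    rlIntegral α (volterraResolvent δ lam g) t
      = volterraResolvent δ lam (rlIntegral α g) t := by
  have hδ0 : 0 ≤ δ := zero_le_one.trans hδ
  have hsum : Summable fun k => rlIntegral α (fun τ => ‖neumannTerm δ lam g k τ‖) t := by
    refine Summable.of_norm_bounded
      ((hg.norm.rlIntegral hα).summable_neumannTerm (lam := -‖lam‖) hδ ht) fun k => ?_
    refine (norm_rlIntegral_le hα ht _).trans ?_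
    simp only [norm_norm]
    rw [← hg.norm.rlIntegral_neumannTerm hδ0 hα ht]
    exact rlIntegral_mono hα ht (hg.neumannTerm hδ0 k).norm (hg.norm.neumannTerm hδ0 k)
      fun τ hτ => norm_neumannTerm_le hδ0 hτ g k
  have hint := hasSum_rlIntegral hα ht (fun k => hg.neumannTerm hδ0 k) hsum
    fun τ hτ => (hg.summable_neumannTerm hδ hτ).hasSum
  exact hint.tsum_eq.symm.trans (tsum_congr fun k => hg.rlIntegral_neumannTerm hδ0 hα ht k)

theorem ContIntegrable.volterraResolvent_add_mul_rlIntegral (hg : ContIntegrable g) (hδ : 1 ≤ δ)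
    (ht : 0 < t) :
    volterraResolvent δ lam g t
      + lam * rlIntegral δ (volterraResolvent δ lam g) t = g t := by
  have hδ0 : 0 ≤ δ := zero_le_one.trans hδ
  calc _ = (g t + ∑' k, neumannTerm δ lam g (k + 1) t)
        + lam * volterraResolvent δ lam (rlIntegral δ g) t := by
        rw [hg.rlIntegral_volterraResolvent hδ hδ0 ht, volterraResolvent,
          (hg.summable_neumannTerm hδ ht).tsum_eq_zero_add, neumannTerm_zero]
    _ = g t := by
        simp only [hg.neumannTerm_succ hδ0 ht, tsum_mul_left, volterraResolvent]
        ring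

theorem volterraResolvent_const_mul (c : 𝕜) (g : ℝ → 𝕜) (t : ℝ) :
    volterraResolvent δ lam (fun τ => c * g τ) t = c * volterraResolvent δ lam g t := by
  simp only [volterraResolvent, neumannTerm_const_mul, tsum_mul_left]

theorem volterraResolvent_add (hg : ContIntegrable g) (hh : ContIntegrable h) (hδ : 1 ≤ δ)
    (ht : 0 < t) :
    volterraResolvent δ lam (fun τ => g τ + h τ) t
      = volterraResolvent δ lam g t + volterraResolvent δ lam h t := by
  have hadd (k : ℕ) : neumannTerm δ lam (fun τ => g τ + h τ) k t
      = neumannTerm δ lam g k t + neumannTerm δ lam h k t := by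
    rw [neumannTerm, rlIntegral_add (by positivity) ht hg hh, mul_add, neumannTerm, neumannTerm]
  simp only [volterraResolvent, hadd]
  exact (hg.summable_neumannTerm hδ ht).tsum_add (hh.summable_neumannTerm hδ ht)

theorem eqOn_volterraResolvent {u : ℝ → 𝕜} (hg : ContIntegrable g) (hu : ContIntegrable u)
    (hδ : 1 ≤ δ) (e : ∀ t, 0 < t → u t + lam * rlIntegral δ u t = g t) :
    EqOn u (volterraResolvent δ lam g) (Ioi 0) := by
  have hδ0 : 0 ≤ δ := zero_le_one.trans hδ
  have hR := hg.volterraResolvent (lam := lam) hδ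
  set d : ℝ → 𝕜 := fun t => u t - volterraResolvent δ lam g t with hd_def
  have hd : ContIntegrable d := hu.sub hR
  have hfix : EqOn (fun t => -lam * rlIntegral δ d t) d (Ioi 0) := fun t ht => by
    have hRt := hg.volterraResolvent_add_mul_rlIntegral (lam := lam) hδ ht
    simp only [hd_def, rlIntegral_sub hδ0 ht hu hR]
    linear_combination hRt - e t ht
  have hiter (n : ℕ) : ∀ t, 0 < t → neumannTerm δ lam d n t = d t := by
    induction n with
    | zero => exact fun t _ => by rw [neumannTerm_zero]
    | succ n ih =>
      intro t ht
      rw [hd.neumannTerm_succ hδ0 ht, ← neumannTerm_const_mul, neumannTerm_congr hδ0 ht hfix,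
        ih t ht]
  intro t ht
  have hlim := (hd.summable_neumannTerm (lam := lam) hδ ht).tendsto_atTop_zero
  simp only [hiter _ t ht] at hlim
  exact sub_eq_zero.1 (tendsto_nhds_unique tendsto_const_nhds hlim)

end Resolvent

section MittagLeffler

variable {𝕜 : Type*} [RCLike 𝕜] {f : ℝ → 𝕜} {δ t : ℝ}

theorem hasSum_mittagLeffler (lam : 𝕜) {c : ℝ} (hδ : 1 ≤ δ) (hc : 0 < c) (ht : 0 < t) :
    HasSum (fun k : ℕ => (-lam) ^ k * (rlKernel (c + δ * k) t : 𝕜))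
      (((t ^ (c - 1) : ℝ) : 𝕜) * mittagLeffler δ c (-lam * ((t ^ δ : ℝ) : 𝕜))) := by
  have hsum : Summable fun k : ℕ => (-lam) ^ k * (rlKernel (c + δ * k) t : 𝕜) := by
    refine Summable.of_norm_bounded
      (summable_pow_mul_rlKernel (norm_nonneg lam) ht hδ hc.le) fun k => ?_
    rw [norm_mul, norm_pow, norm_neg, RCLike.norm_ofReal,
      abs_of_nonneg (rlKernel_nonneg (by positivity) ht.le)]
  convert hsum.hasSum using 1
  rw [mittagLeffler, ← tsum_mul_left]
  refine tsum_congr fun k => ?_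
  have hpow : t ^ (c + δ * k - 1) = t ^ (c - 1) * (t ^ δ) ^ k := by
    rw [← Real.rpow_natCast, ← Real.rpow_mul ht.le, ← Real.rpow_add ht]
    congr 1; ring
  rw [rlKernel, hpow, mul_pow, add_comm c]
  push_cast
  ring

theorem volterraResolvent_rlKernel (lam : 𝕜) {c : ℝ} (hδ : 1 ≤ δ) (hc : 0 < c) (ht : 0 < t) :
    volterraResolvent δ lam (fun τ => (rlKernel c τ : 𝕜)) t
      = ((t ^ (c - 1) : ℝ) : 𝕜) * mittagLeffler δ c (-lam * ((t ^ δ : ℝ) : 𝕜)) := by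
  simp only [volterraResolvent, neumannTerm_rlKernel (zero_le_one.trans hδ) hc ht]
  exact (hasSum_mittagLeffler lam hδ hc ht).tsum_eq

theorem ContIntegrable.volterraResolvent_rlIntegral (hf : ContIntegrable f) (hδ : 1 ≤ δ)
    (lam : 𝕜) (ht : 0 < t) :
    volterraResolvent δ lam (rlIntegral δ f) t
      = ∫ τ in (0 : ℝ)..t, (((t - τ) ^ (δ - 1) : ℝ) : 𝕜)
        * mittagLeffler δ δ (-lam * (((t - τ) ^ δ : ℝ) : 𝕜)) * f τ := by
  have hδ0 : 0 < δ := one_pos.trans_le hδ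
  have hk (k : ℕ) : 0 < δ + δ * k := by positivity
  have hint := hasSum_intervalIntegral_of_summable_integral_norm ht.le
    (F := fun k τ => (-lam) ^ k * (rlKernel (δ + δ * k) (t - τ) : 𝕜) * f τ) ?integrable ?summable
    fun τ hτ => (hasSum_mittagLeffler lam hδ hδ0 (sub_pos.2 hτ.2)).mul_right (f τ)
  case integrable =>
    intro k
    simp only [mul_assoc, ← RCLike.real_smul_eq_coe_mul]
    exact (hf.intervalIntegrable_rlKernel_smul (hk k) ht).const_mul _
  case summable =>
    refine ((hf.norm.rlIntegral hδ0.le).summable_neumannTerm (lam := -‖lam‖) hδ ht).congr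
      fun k => ?_
    rw [neumannTerm, hf.norm.rlIntegral_rlIntegral (by positivity) hδ0.le ht, add_comm,
      rlIntegral_of_pos (hk k), neg_neg, ← intervalIntegral.integral_const_mul]
    refine intervalIntegral.integral_congr_Ioo_of_le ht.le fun τ hτ => ?_
    simp only [norm_mul, norm_pow, norm_neg, RCLike.norm_ofReal, smul_eq_mul, mul_assoc,
      abs_of_nonneg (rlKernel_nonneg (hk k) (sub_nonneg.2 hτ.2.le))]
  rw [← hint.tsum_eq]
  refine tsum_congr fun k => ?_
  rw [neumannTerm, hf.rlIntegral_rlIntegral (by positivity) hδ0.le ht, add_comm,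
    rlIntegral_of_pos (hk k), ← intervalIntegral.integral_const_mul]
  simp only [RCLike.real_smul_eq_coe_mul, mul_assoc]

end MittagLeffler

section Range

theorem eq_zero_of_tendsto_of_integrableOn_inv_smul {E : Type*} [NormedAddCommGroup E]
    [NormedSpace ℝ E] {p : ℝ → E} {L : E} (hp : Tendsto p (𝓝[>] 0) (𝓝 L))
    (hi : IntegrableOn (fun t : ℝ => t⁻¹ • p t) (Ioc 0 1)) : L = 0 := by
  by_contra hL
  have hlow : ∀ᶠ t in 𝓝[>] (0 : ℝ), ‖t⁻¹‖ ≤ (‖L‖ / 2)⁻¹ * ‖t⁻¹ • p t‖ := by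
    filter_upwards [hp.norm.eventually_const_lt (half_lt_self (norm_pos_iff.2 hL))] with t ht
    rw [norm_smul, mul_left_comm]
    refine le_mul_of_one_le_right (norm_nonneg _) ?_
    rw [inv_mul_eq_div, one_le_div (half_pos (norm_pos_iff.2 hL))]
    exact ht.le
  have hinv : IntegrableAtFilter (fun t : ℝ => t⁻¹) (𝓝[>] 0) volume :=
    (Asymptotics.IsBigO.of_bound _ hlow).integrableAtFilter
      measurable_inv.stronglyMeasurable.stronglyMeasurableAtFilter
      ⟨Ioc 0 1, Ioc_mem_nhdsGT one_pos, hi⟩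
  obtain ⟨s, hs, hint⟩ := hinv
  obtain ⟨ε, hε, hεs⟩ := mem_nhdsGT_iff_exists_Ioc_subset.1 hs
  have hε0 : (0 : ℝ) < ε := hε
  have hε' := (intervalIntegrable_iff_integrableOn_Ioc_of_le hε0.le).2 (hint.mono_set hεs)
  simp [intervalIntegrable_inv_iff, hε0.ne, hε0.le] at hε'

theorem eq_rlIntegral_one_of_integrableOn_inv_smul {𝕜 : Type*} [RCLike 𝕜] {g p : ℝ → 𝕜}
    (hg : ContIntegrable g) (hp : ∀ t, 0 < t → HasDerivAt p (g t) t)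
    (hi : IntegrableOn (fun t : ℝ => t⁻¹ • p t) (Ioc 0 1)) {t : ℝ} (ht : 0 < t) :
    p t = rlIntegral 1 g t := by
  set L := p 1 - rlIntegral 1 g 1
  have hconst : ∀ s, 0 < s → p s = L + rlIntegral 1 g s := fun s hs => by
    have hftc := intervalIntegral.integral_eq_sub_of_hasDerivAt
      (fun x hx => hp x ((lt_min one_pos hs).trans_le hx.1))
      (hg.intervalIntegrable zero_le_one hs.le)
    simp only [L, rlIntegral_one, ← intervalIntegral.integral_add_adjacent_intervals
      (hg.intervalIntegrable le_rfl zero_le_one) (hg.intervalIntegrable zero_le_one hs.le), hftc]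
    ring
  have hlim : Tendsto p (𝓝[>] 0) (𝓝 (L + 0)) :=
    (hg.tendsto_rlIntegral_one.const_add L).congr'
      (eventually_nhdsWithin_of_forall fun s hs => (hconst s hs).symm)
  rw [hconst t ht, ← add_zero L, eq_zero_of_tendsto_of_integrableOn_inv_smul hlim hi, zero_add]

theorem integrableOn_Ioi_integral_smul_comp_mul {E : Type*} [NormedAddCommGroup E]
    [NormedSpace ℝ E] {κ : ℝ → ℝ} {w : ℝ → E} {S : Set ℝ} (hS : MeasurableSet S)
    (hS0 : S ⊆ Ioi 0) (hκ : IntegrableOn κ S) (hw : StronglyMeasurable w)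
    (hwi : IntegrableOn w (Ioi 0)) :
    IntegrableOn (fun t => ∫ x in S, κ x • x • w (t * x)) (Ioi 0) := by
  have hmeas : AEStronglyMeasurable (fun q : ℝ × ℝ => κ q.2 • q.2 • w (q.1 * q.2))
      ((volume.restrict (Ioi 0)).prod (volume.restrict S)) :=
    hκ.aestronglyMeasurable.comp_snd.smul
      (measurable_snd.stronglyMeasurable.smul
        (hw.comp_measurable (measurable_fst.mul measurable_snd))).aestronglyMeasurable
  refine Integrable.integral_prod_left ((integrable_prod_iff' hmeas).2 ⟨?_, ?_⟩)
  · refine (ae_restrict_mem hS).mono fun x hx => ?_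
    exact (((integrableOn_Ioi_comp_mul_right_iff w 0 (hS0 hx)).2
      (by rwa [zero_mul])).smul x).smul (κ x)
  · refine (hκ.norm.mul_const (∫ t in Ioi 0, ‖w t‖)).congr
      ((ae_restrict_mem hS).mono fun x hx => ?_)
    have hx0 : 0 < x := hS0 hx
    have hscale := integral_comp_mul_right_Ioi (fun t => ‖w t‖) 0 hx0
    simp only [zero_mul, smul_eq_mul] at hscale
    simp only [norm_smul, integral_const_mul, hscale, Real.norm_of_nonneg hx0.le,
      mul_inv_cancel_left₀ hx0.ne']

theorem ContIntegrable.integrableOn_integral_smul_comp_mul {𝕜 : Type*} [RCLike 𝕜] {κ : ℝ → ℝ}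
    {w : ℝ → 𝕜} {S : Set ℝ} (hw : ContIntegrable w) (hS : MeasurableSet S) (hS0 : S ⊆ Ioi 0)
    (hκ : IntegrableOn κ S) (T : ℝ) :
    IntegrableOn (fun t => ∫ x in S, κ x • x • (Ioc 0 T).indicator w (t * x)) (Ioi 0) := by
  refine integrableOn_Ioi_integral_smul_comp_mul hS hS0 hκ ?_ ?_
  · classical
    rw [← piecewise_eq_indicator]
    exact ((hw.continuousOn.mono Ioc_subset_Ioi_self).measurable_piecewise continuousOn_const
      measurableSet_Ioc).stronglyMeasurable
  · rcases le_or_gt T 0 with hT | hT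
    · simp [Ioc_eq_empty_of_le hT]
    · exact ((integrable_indicator_iff measurableSet_Ioc).2 (hw.integrableOn T hT)).integrableOn

theorem ContIntegrable.inv_smul_rlIntegral {𝕜 : Type*} [RCLike 𝕜] {g : ℝ → 𝕜} {α : ℝ}
    (hα : 0 < α) (hα1 : α < 1) (hg : ContIntegrable g)
    (hw : ContIntegrable fun t => t ^ (α - 1) • g t) :
    ContIntegrable fun t => t⁻¹ • rlIntegral α g t := by
  refine ⟨(continuousOn_inv₀.mono fun _ hx => ne_of_gt hx).smul (hg.continuousOn_rlIntegral hα),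
    fun T _ => ?_⟩
  have hκ : IntegrableOn (fun x => rlKernel α (1 - x) • rlKernel (1 - α) x) (Ioo 0 1) :=
    (intervalIntegrable_iff_integrableOn_Ioo_of_le zero_le_one).1
      ((contIntegrable_rlKernel (sub_pos.2 hα1)).intervalIntegrable_rlKernel_smul hα one_pos)
  have hint := (hw.integrableOn_integral_smul_comp_mul measurableSet_Ioo Ioo_subset_Ioi_self hκ
    T).mono_set (Ioc_subset_Ioi_self : Ioc 0 T ⊆ Ioi 0)
  refine IntegrableOn.congr_fun (hint.smul (Real.Gamma (1 - α))) (fun t ht => ?_) measurableSet_Ioc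
  have ht0 : 0 < t := ht.1
  have hscale := intervalIntegral.smul_integral_comp_mul_left (a := 0) (b := 1)
    (fun τ => rlKernel α (t - τ) • g τ) t
  rw [mul_zero, mul_one, ← rlIntegral_of_pos hα] at hscale
  rw [Pi.smul_apply, ← hscale, inv_smul_smul₀ ht0.ne', ← integral_smul,
    intervalIntegral.integral_of_le zero_le_one, integral_Ioc_eq_integral_Ioo]
  refine setIntegral_congr_fun measurableSet_Ioo fun x ⟨hx0, hx1⟩ => ?_
  have htx : t * x ∈ Ioc 0 T := ⟨by positivity, by nlinarith [ht.2]⟩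
  have hΓ := (Real.Gamma_pos_of_pos (sub_pos.2 hα1)).ne'
  simp only [indicator_of_mem htx, smul_smul, smul_eq_mul]
  congr 1
  rw [show t - t * x = t * (1 - x) by ring, rlKernel, rlKernel, rlKernel,
    Real.mul_rpow ht0.le hx0.le, Real.mul_rpow ht0.le (sub_nonneg.2 hx1.le), sub_sub_cancel_left,
    Real.rpow_neg hx0.le, Real.rpow_sub_one hx0.ne']
  have := (Real.rpow_pos_of_pos hx0 α).ne'
  field_simp

theorem integral_rpow_smul_comp_mul_deriv {E : Type*} [NormedAddCommGroup E] [NormedSpace ℝ E]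
    [CompleteSpace E] {f f' : ℝ → E} {t : ℝ} (ht : t ∈ Ioc 0 1)
    (hd : ∀ s, 0 < s → HasDerivAt f (f' s) s) (hf' : ContinuousOn f' (Ioi 0)) (b : ℝ) :
    ∫ x in Ioi 1, x ^ (b - 2) • x • (Ioc 0 1).indicator (fun s => s ^ (1 - b) • f' s) (t * x)
      = t ^ (-b) • (f 1 - f t) := by
  obtain ⟨ht0, ht1⟩ := ht
  have hpos : ∀ s ∈ uIcc t 1, 0 < s := fun s hs => (lt_min ht0 one_pos).trans_le hs.1
  have hftc : ∫ s in t..1, f' s = f 1 - f t :=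
    intervalIntegral.integral_eq_sub_of_hasDerivAt (fun s hs => hd s (hpos s hs))
      (hf'.mono hpos).intervalIntegrable
  have hcut : EqOn
      (fun x => x ^ (b - 2) • x • (Ioc 0 1).indicator (fun s => s ^ (1 - b) • f' s) (t * x))
      ((Iic t⁻¹).indicator fun x => t ^ (1 - b) • f' (t * x)) (Ioi 1) := fun x hx => by
    have hx0 : 0 < x := one_pos.trans hx
    by_cases hxt : x ≤ t⁻¹
    · have htx : t * x ∈ Ioc 0 1 := ⟨by positivity, (le_inv_mul_iff₀ ht0).1 (by rwa [mul_one])⟩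
      simp only [indicator_of_mem (mem_Iic.2 hxt), indicator_of_mem htx, smul_smul]
      rw [Real.mul_rpow ht0.le hx0.le, show b - 2 = -(1 - b) - 1 by ring,
        Real.rpow_sub_one hx0.ne', Real.rpow_neg hx0.le]
      have := (Real.rpow_pos_of_pos hx0 (1 - b)).ne'
      congr 1
      field_simp
    · have htx : t * x ∉ Ioc 0 1 := fun h => hxt (by simpa using (le_inv_mul_iff₀ ht0).2 h.2)
      simp only [indicator_of_notMem (mt mem_Iic.1 hxt), indicator_of_notMem htx, smul_zero]
  rw [setIntegral_congr_fun measurableSet_Ioi hcut, setIntegral_indicator measurableSet_Iic,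
    Ioi_inter_Iic, ← intervalIntegral.integral_of_le ((one_le_inv₀ ht0).2 ht1),
    intervalIntegral.integral_smul, intervalIntegral.integral_comp_mul_left _ ht0.ne', mul_one,
    mul_inv_cancel₀ ht0.ne', hftc, smul_smul, sub_eq_neg_add, Real.rpow_add_one ht0.ne',
    mul_inv_cancel_right₀ ht0.ne']

theorem ContIntegrable.rpow_neg_smul_of_deriv {𝕜 : Type*} [RCLike 𝕜] {f f' : ℝ → 𝕜} {b : ℝ}
    (hb1 : b < 1) (hf : ContinuousOn f (Ioi 0)) (hd : ∀ t, 0 < t → HasDerivAt f (f' t) t)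
    (hf' : ContIntegrable fun t => t ^ (1 - b) • f' t) :
    ContIntegrable fun t => t ^ (-b) • f t := by
  have hκ : IntegrableOn (fun x : ℝ => x ^ (b - 2)) (Ioi 1) :=
    integrableOn_Ioi_rpow_of_lt (by linarith) one_pos
  have hf'c : ContinuousOn f' (Ioi 0) :=
    ((continuousOn_id.rpow_const (p := b - 1) fun _ ht => .inl (ne_of_gt ht)).smul
      hf'.continuousOn).congr fun t (ht : 0 < t) => by
        simp only [Pi.smul_apply', id, smul_smul, ← Real.rpow_add ht, sub_add_sub_cancel, sub_self,
          Real.rpow_zero, one_smul]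
  refine .of_integrableOn_one
    ((continuousOn_id.rpow_const fun _ ht => .inl (ne_of_gt ht)).smul hf) ?_
  have hint := (hf'.integrableOn_integral_smul_comp_mul measurableSet_Ioi
    (Ioi_subset_Ioi zero_le_one) hκ 1).mono_set (Ioc_subset_Ioi_self : Ioc (0 : ℝ) 1 ⊆ Ioi 0)
  have hpow := (intervalIntegrable_iff_integrableOn_Ioc_of_le zero_le_one).1
    (intervalIntegral.intervalIntegrable_rpow' (r := -b) (by linarith))
  refine IntegrableOn.congr_fun ((hpow.smul_const (f 1)).sub hint) (fun t ht => ?_)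
    measurableSet_Ioc
  simp only [Pi.sub_apply, integral_rpow_smul_comp_mul_deriv ht hd hf'c b]
  rw [← smul_sub, sub_sub_cancel]

theorem mul_rlKernel {α t : ℝ} (hα : 0 < α) (ht : 0 < t) :
    t * rlKernel α t = α * rlKernel (α + 1) t := by
  rw [rlKernel, rlKernel, Real.Gamma_add_one hα.ne', add_sub_right_comm, Real.rpow_add_one ht.ne']
  field_simp

variable {𝕜 : Type*} [RCLike 𝕜] {f f' : ℝ → 𝕜} {α b : ℝ}

theorem ContIntegrable.smul_rlIntegral {t : ℝ} (hf : ContIntegrable f) (hα : 0 < α) (ht : 0 < t) :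
    t • rlIntegral α f t
      = rlIntegral α (fun τ => τ • f τ) t + α • rlIntegral (α + 1) f t := by
  have hsplit : ∀ τ ∈ Ioo 0 t, t • rlKernel α (t - τ) • f τ
      = rlKernel α (t - τ) • τ • f τ + α • rlKernel (α + 1) (t - τ) • f τ := fun τ hτ => by
    rw [smul_smul α, ← mul_rlKernel hα (sub_pos.2 hτ.2)]
    module
  have hα' : 0 < α + 1 := by positivity
  have hi₁ := (hf.continuousOn_smul continuousOn_id).intervalIntegrable_rlKernel_smul hα ht
  have hi₂ := (hf.intervalIntegrable_rlKernel_smul hα' ht).smul α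
  simp only [rlIntegral_of_pos hα, rlIntegral_of_pos hα', ← intervalIntegral.integral_smul]
  exact (intervalIntegral.integral_congr_Ioo_of_le ht.le hsplit).trans
    (intervalIntegral.integral_add hi₁ hi₂)

theorem ContIntegrable.smul_eq_rlIntegral_one (hf : ContIntegrable f)
    (hd : ∀ t, 0 < t → HasDerivAt f (f' t) t) (hf' : ContIntegrable fun t => t • f' t)
    {t : ℝ} (ht : 0 < t) : t • f t = rlIntegral 1 (fun τ => f τ + τ • f' τ) t := by
  refine eq_rlIntegral_one_of_integrableOn_inv_smul (p := fun t => t • f t) (hf.add hf')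
    (fun s hs => ?_) ?_ ht
  · exact ((hasDerivAt_id s).smul (hd s hs)).congr_deriv (by rw [id, one_smul, add_comm])
  · exact (hf.integrableOn 1 one_pos).congr_fun
      (fun s hs => (inv_smul_smul₀ hs.1.ne' _).symm) measurableSet_Ioc

theorem ContIntegrable.smul_rlIntegral_eq_rlIntegral_one (hf : ContIntegrable f)
    (hd : ∀ t, 0 < t → HasDerivAt f (f' t) t) (hf' : ContIntegrable fun t => t • f' t)
    (hα : 0 < α) {t : ℝ} (ht : 0 < t) :
    t • rlIntegral α f t = rlIntegral 1 (rlIntegral α fun τ => f τ + (α * f τ + τ • f' τ)) t := by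
  have hψ := (hf.const_mul (α : 𝕜)).add hf'
  rw [(hf.add hψ).rlIntegral_rlIntegral zero_le_one hα.le ht, hf.smul_rlIntegral hα ht,
    rlIntegral_congr hα.le ht fun _ hs => hf.smul_eq_rlIntegral_one hd hf' hs,
    (hf.add hf').rlIntegral_rlIntegral hα.le zero_le_one ht, RCLike.real_smul_eq_coe_mul,
    ← rlIntegral_const_mul,
    ← rlIntegral_add (by linarith) ht (hf.add hf') (hf.const_mul _), add_comm 1]
  simp only [add_assoc, add_comm]

theorem ContIntegrable.hasDerivAt_rlIntegral (hf : ContIntegrable f)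
    (hd : ∀ t, 0 < t → HasDerivAt f (f' t) t) (hf' : ContIntegrable fun t => t • f' t)
    (hα : 0 < α) {t : ℝ} (ht : 0 < t) :
    HasDerivAt (rlIntegral α f) (t⁻¹ • rlIntegral α (fun τ => α * f τ + τ • f' τ) t) t := by
  have hψ := (hf.const_mul (α : 𝕜)).add hf'
  have hquot := (hasDerivAt_inv ht.ne').smul
    (((hf.add hψ).rlIntegral hα.le).hasDerivAt_rlIntegral_one ht)
  refine (hquot.congr_of_eventuallyEq ?_).congr_deriv ?_
  · filter_upwards [Ioi_mem_nhds ht] with s (hs : 0 < s)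
    rw [Pi.smul_apply', ← hf.smul_rlIntegral_eq_rlIntegral_one hd hf' hα hs,
      inv_smul_smul₀ hs.ne']
  · rw [← hf.smul_rlIntegral_eq_rlIntegral_one hd hf' hα ht, rlIntegral_add hα.le ht hf hψ,
      smul_smul, show -(t ^ 2)⁻¹ * t = -t⁻¹ by field_simp]
    module

end Range

/-- `f` agrees on `(0, ∞)` with the fractional integral of order `α` of a function that is
continuous on `(0, ∞)` and integrable near `0`. -/
def IsRLIntegral {𝕜 : Type*} [RCLike 𝕜] (α : ℝ) (f : ℝ → 𝕜) : Prop :=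
  ∃ φ : ℝ → 𝕜, ContIntegrable φ ∧ EqOn (rlIntegral α φ) f (Ioi 0)

namespace IsRLIntegral

variable {𝕜 : Type*} [RCLike 𝕜] {f f' : ℝ → 𝕜} {b : ℝ}

theorem of_rlIntegral_one_sub {φ : ℝ → 𝕜} (hf : ContIntegrable f) (hφ : ContIntegrable φ)
    (hb : 0 ≤ b) (hb1 : b ≤ 1) (e : EqOn (rlIntegral (1 - b) f) (rlIntegral 1 φ) (Ioi 0)) :
    IsRLIntegral b f := by
  refine ⟨φ, hφ, (hφ.rlIntegral hb).eqOn_of_rlIntegral_eqOn hf (sub_nonneg.2 hb1)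
    (sub_le_self _ hb) fun t ht => ?_⟩
  rw [hφ.rlIntegral_rlIntegral (sub_nonneg.2 hb1) hb ht, sub_add_cancel, e ht]

theorem of_rpow_smul_deriv (hf : ContIntegrable f) (hd : ∀ t, 0 < t → HasDerivAt f (f' t) t)
    (hf' : ContIntegrable fun t => t ^ (1 - b) • f' t) (hb : 0 < b) (hb1 : b < 1) :
    IsRLIntegral b f := by
  have hb' : 0 < 1 - b := sub_pos.2 hb1
  have htf' : ContIntegrable fun t => t • f' t :=
    (hf'.continuousOn_smul (Real.continuous_rpow_const hb.le).continuousOn).congr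
      fun t (ht : 0 < t) => by
        simp only [smul_smul, ← Real.rpow_add ht, add_sub_cancel, Real.rpow_one]
  have hbf := hf'.rpow_neg_smul_of_deriv hb1 hf.continuousOn hd
  have hφ : ContIntegrable fun t => t⁻¹ • rlIntegral (1 - b)
      (fun τ => ((1 - b : ℝ) : 𝕜) * f τ + τ • f' τ) t := by
    refine ((hf.const_mul _).add htf').inv_smul_rlIntegral hb' (sub_lt_self _ hb)
      (((hbf.const_mul ((1 - b : ℝ) : 𝕜)).add hf').congr fun t (ht : 0 < t) => ?_)
    simp only [sub_sub_cancel_left, smul_add, mul_smul_comm, smul_smul, ← Real.rpow_add_one ht.ne',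
      neg_add_eq_sub]
  refine of_rlIntegral_one_sub hf hφ hb.le hb1.le fun t ht =>
    eq_rlIntegral_one_of_integrableOn_inv_smul hφ
      (fun s hs => hf.hasDerivAt_rlIntegral hd htf' hb' hs) ?_ ht
  refine (hf.inv_smul_rlIntegral hb' (sub_lt_self _ hb) ?_).integrableOn 1 one_pos
  simpa only [sub_sub_cancel_left] using hbf

theorem of_contDiffOn (hf : ContDiffOn ℝ 1 f (Ioi 0)) (hfi : IntegrableOn f (Ioc 0 1))
    (hb : 0 ≤ b) (hb1 : b < 1)
    (h : b = 0 ∨ IntegrableOn (fun t : ℝ => t ^ (1 - b) • deriv f t) (Ioc 0 1)) :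
    IsRLIntegral b f := by
  have hfc : ContIntegrable f := .of_integrableOn_one hf.continuousOn hfi
  rcases hb.eq_or_lt with rfl | hb
  · exact ⟨f, hfc, fun t _ => by rw [rlIntegral_zero]⟩
  refine of_rpow_smul_deriv hfc (fun t ht => ((hf.differentiableOn one_ne_zero).differentiableAt
    (Ioi_mem_nhds ht)).hasDerivAt) ?_ hb hb1
  exact .of_integrableOn_one ((continuousOn_id.rpow_const fun _ ht => .inl (ne_of_gt ht)).smul
    (hf.continuousOn_deriv_of_isOpen isOpen_Ioi le_rfl)) (h.resolve_left hb.ne')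

end IsRLIntegral

namespace IsRLIntegral

variable {𝕜 : Type*} [RCLike 𝕜] {f u : ℝ → 𝕜} {b : ℝ}

theorem add_const_mul (hf : IsRLIntegral b f) (hu : IsRLIntegral b u) (hb : 0 ≤ b) (c : 𝕜) :
    IsRLIntegral b fun t => f t + c * u t := by
  obtain ⟨φ, hφ, hφf⟩ := hf
  obtain ⟨χ, hχ, hχu⟩ := hu
  refine ⟨_, hφ.add (hχ.const_mul c), fun t ht => ?_⟩
  rw [rlIntegral_add hb ht hφ (hχ.const_mul c), rlIntegral_const_mul, hφf ht, hχu ht]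

theorem congr (hf : IsRLIntegral b f) (e : EqOn f u (Ioi 0)) : IsRLIntegral b u :=
  let ⟨φ, hφ, hφf⟩ := hf
  ⟨φ, hφ, hφf.trans e⟩

theorem sub_const_mul_iff (hu : IsRLIntegral b u) (hb : 0 ≤ b) (c : 𝕜) :
    IsRLIntegral b (fun t => f t - c * u t) ↔ IsRLIntegral b f := by
  refine ⟨fun h => ?_, fun h => ?_⟩
  · simpa only [sub_add_cancel] using h.add_const_mul hu hb c
  · simpa only [neg_mul, ← sub_eq_add_neg] using h.add_const_mul hu hb (-c)

end IsRLIntegral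

section Taylor

variable {𝕜 : Type*} [RCLike 𝕜] {p g v w : ℝ → 𝕜} {L : 𝕜}

theorem ContIntegrable.eqOn_const_add_rlIntegral_one_iff (hg : ContIntegrable g) :
    EqOn p (fun t => L + rlIntegral 1 g t) (Ioi 0) ↔
      (∀ t, 0 < t → HasDerivAt p (g t) t) ∧ Tendsto p (𝓝[>] 0) (𝓝 L) := by
  refine ⟨fun e => ⟨fun t ht => ?_, ?_⟩, fun ⟨hp, hL⟩ t ht => eq_add_rlIntegral_one hg hp hL ht⟩
  · exact ((hg.hasDerivAt_rlIntegral_one ht).const_add L).congr_of_eventuallyEq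
      (e.eventuallyEq_of_mem (Ioi_mem_nhds ht))
  · have hlim := hg.tendsto_rlIntegral_one.const_add L
    rw [add_zero] at hlim
    exact hlim.congr' (eventually_nhdsWithin_of_forall e.symm)

theorem contDiffOn_two_iff_hasDerivAt (hw : ContinuousOn w (Ioi 0)) :
    ContDiffOn ℝ 2 v (Ioi 0) ∧ EqOn (iteratedDeriv 2 v) w (Ioi 0) ↔
      (∀ t, 0 < t → HasDerivAt v (deriv v t) t) ∧
        ∀ t, 0 < t → HasDerivAt (deriv v) (w t) t := by
  rw [iteratedDeriv_succ, iteratedDeriv_one, ← one_add_one_eq_two,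
    contDiffOn_succ_iff_deriv_of_isOpen isOpen_Ioi, ← zero_add (1 : WithTop ℕ∞),
    contDiffOn_succ_iff_deriv_of_isOpen isOpen_Ioi, contDiffOn_zero]
  constructor
  · rintro ⟨⟨hv, -, hv', -, -⟩, e⟩
    exact ⟨fun t ht => (hv.differentiableAt (Ioi_mem_nhds ht)).hasDerivAt,
      fun t ht => e ht ▸ (hv'.differentiableAt (Ioi_mem_nhds ht)).hasDerivAt⟩
  · rintro ⟨hv, hv'⟩
    have e : EqOn (deriv (deriv v)) w (Ioi 0) := fun t ht => (hv' t ht).deriv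
    exact ⟨⟨fun t ht => (hv t ht).differentiableAt.differentiableWithinAt, by simp,
      fun t ht => (hv' t ht).differentiableAt.differentiableWithinAt, by simp, hw.congr e⟩, e⟩

end Taylor

/-- The fractional Taylor expression `ξ₀ t ^ (c - 1) / Γ(c) + ξ₁ t ^ c / Γ(c + 1) + I^α h(t)`.
For `c = 1` and `α = 2` this is Taylor's formula at `0` for a function with second derivative `h`,
and `I^ν` raises both `c` and `α` by `ν`. -/
noncomputable def fracTaylor {𝕜 : Type*} [RCLike 𝕜] (ξ₀ ξ₁ : 𝕜) (c α : ℝ) (h : ℝ → 𝕜) (t : ℝ) :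
    𝕜 :=
  ξ₀ * rlKernel c t + ξ₁ * rlKernel (c + 1) t + rlIntegral α h t

section FracTaylor

variable {𝕜 : Type*} [RCLike 𝕜] {f h u v w : ℝ → 𝕜} {ξ₀ ξ₁ lam : 𝕜} {a b c α δ ν t : ℝ}

protected theorem ContIntegrable.fracTaylor (hh : ContIntegrable h) (hc : 0 < c) (hα : 0 ≤ α) :
    ContIntegrable (fracTaylor ξ₀ ξ₁ c α h) :=
  (((contIntegrable_rlKernel hc).ofReal.const_mul _).add
    ((contIntegrable_rlKernel (by linarith)).ofReal.const_mul _)).add (hh.rlIntegral hα)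

theorem ContIntegrable.rlIntegral_fracTaylor (hh : ContIntegrable h) (hc : 0 < c) (hα : 0 ≤ α)
    (hν : 0 ≤ ν) (ht : 0 < t) :
    rlIntegral ν (fracTaylor ξ₀ ξ₁ c α h) t = fracTaylor ξ₀ ξ₁ (c + ν) (ν + α) h t := by
  have hc1 : 0 < c + 1 := by linarith
  have h₀ := (contIntegrable_rlKernel hc).ofReal.const_mul ξ₀
  have h₁ := (contIntegrable_rlKernel hc1).ofReal.const_mul ξ₁
  unfold fracTaylor
  rw [rlIntegral_add hν ht (h₀.add h₁) (hh.rlIntegral hα), rlIntegral_add hν ht h₀ h₁,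
    rlIntegral_const_mul, rlIntegral_const_mul, rlIntegral_rlKernel hν hc ht,
    rlIntegral_rlKernel hν hc1 ht, hh.rlIntegral_rlIntegral hν hα ht, add_right_comm c 1 ν]

theorem ContIntegrable.fracTaylor_of_eqOn_rlIntegral (hw : ContIntegrable w) (hα : 0 ≤ α)
    (hb : 0 ≤ b) (ht : 0 < t) (e : EqOn (rlIntegral b w) h (Ioi 0)) :
    fracTaylor ξ₀ ξ₁ c α h t = fracTaylor ξ₀ ξ₁ c (α + b) w t := by
  rw [fracTaylor, fracTaylor, ← rlIntegral_congr hα ht e, hw.rlIntegral_rlIntegral hα hb ht]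

theorem ContIntegrable.eqOn_rlIntegral_fracTaylor_iff (hu : ContIntegrable u)
    (hh : ContIntegrable h) (hc : 0 < c) (hα : 0 ≤ α) (ha : 0 ≤ a) (ha1 : a ≤ 1) :
    EqOn (rlIntegral a u) (fracTaylor ξ₀ ξ₁ (c + a) (a + α) h) (Ioi 0) ↔
      EqOn u (fracTaylor ξ₀ ξ₁ c α h) (Ioi 0) := by
  refine ⟨fun e => hu.eqOn_of_rlIntegral_eqOn (hh.fracTaylor hc hα) ha ha1 fun t ht => ?_,
    fun e t ht => ?_⟩
  · rw [e ht, hh.rlIntegral_fracTaylor hc hα ha ht]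
  · rw [rlIntegral_congr ha ht e, hh.rlIntegral_fracTaylor hc hα ha ht]

theorem ContIntegrable.fracTaylor_one_two (hw : ContIntegrable w) (ht : 0 < t) :
    fracTaylor ξ₀ ξ₁ 1 2 w t = ξ₀ + rlIntegral 1 (fun s => ξ₁ + rlIntegral 1 w s) t := by
  have hone : ContIntegrable fun t => ξ₁ * (rlKernel 1 t : 𝕜) :=
    (contIntegrable_rlKernel one_pos).ofReal.const_mul ξ₁
  have hsum := rlIntegral_add zero_le_one ht hone (hw.rlIntegral zero_le_one)
  rw [rlIntegral_const_mul, rlIntegral_rlKernel zero_le_one one_pos ht,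
    hw.rlIntegral_rlIntegral zero_le_one zero_le_one ht, one_add_one_eq_two] at hsum
  simp only [rlKernel_one, RCLike.ofReal_one, mul_one] at hsum
  rw [hsum, fracTaylor, rlKernel_one, RCLike.ofReal_one, mul_one, one_add_one_eq_two, add_assoc]

theorem ContIntegrable.eqOn_fracTaylor_one_two_iff (hw : ContIntegrable w) :
    EqOn v (fracTaylor ξ₀ ξ₁ 1 2 w) (Ioi 0) ↔
      (ContDiffOn ℝ 2 v (Ioi 0) ∧ EqOn (iteratedDeriv 2 v) w (Ioi 0)) ∧
        Tendsto v (𝓝[>] 0) (𝓝 ξ₀) ∧ Tendsto (deriv v) (𝓝[>] 0) (𝓝 ξ₁) := by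
  have hg : ContIntegrable fun s => ξ₁ + rlIntegral 1 w s := by
    simpa only [rlKernel_one, RCLike.ofReal_one, mul_one] using
      ((contIntegrable_rlKernel one_pos).ofReal.const_mul ξ₁).add (hw.rlIntegral zero_le_one)
  have htaylor : EqOn (fracTaylor ξ₀ ξ₁ 1 2 w)
      (fun t => ξ₀ + rlIntegral 1 (fun s => ξ₁ + rlIntegral 1 w s) t) (Ioi 0) :=
    fun _ ht => hw.fracTaylor_one_two ht
  rw [contDiffOn_two_iff_hasDerivAt hw.continuousOn]
  constructor
  · intro e
    obtain ⟨hv, h0⟩ := hg.eqOn_const_add_rlIntegral_one_iff.1 (e.trans htaylor)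
    obtain ⟨hv', h1⟩ := hw.eqOn_const_add_rlIntegral_one_iff.1 fun t ht => (hv t ht).deriv
    exact ⟨⟨fun t ht => (hv t ht).differentiableAt.hasDerivAt, hv'⟩, h0, h1⟩
  · rintro ⟨⟨hv, hv'⟩, h0, h1⟩
    have e := hw.eqOn_const_add_rlIntegral_one_iff.2 ⟨hv', h1⟩
    exact (hg.eqOn_const_add_rlIntegral_one_iff.2
      ⟨fun t ht => (hv t ht).congr_deriv (e ht), h0⟩).trans htaylor.symm

theorem ContIntegrable.add_mul_rlIntegral_eq_fracTaylor_iff (hf : ContIntegrable f)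
    (hu : ContIntegrable u) (hδ : 0 ≤ δ) (ht : 0 < t) :
    u t + lam * rlIntegral δ u t = fracTaylor ξ₀ ξ₁ c δ f t ↔
      u t = fracTaylor ξ₀ ξ₁ c δ (fun x => f x - lam * u x) t := by
  rw [fracTaylor, fracTaylor, rlIntegral_sub hδ ht hf (hu.const_mul lam), rlIntegral_const_mul,
    ← eq_sub_iff_add_eq, add_sub_assoc]

theorem ContIntegrable.isRLIntegral_fracTaylor (hh : ContIntegrable h) (hb : 0 ≤ b) (hbc : b < c)
    (hbα : b ≤ α) : IsRLIntegral b (fracTaylor ξ₀ ξ₁ c α h) := by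
  refine ⟨fracTaylor ξ₀ ξ₁ (c - b) (α - b) h,
    hh.fracTaylor (sub_pos.2 hbc) (sub_nonneg.2 hbα), fun t ht => ?_⟩
  rw [hh.rlIntegral_fracTaylor (sub_pos.2 hbc) (sub_nonneg.2 hbα) hb ht, sub_add_cancel,
    add_sub_cancel]

theorem ContIntegrable.volterraResolvent_fracTaylor (hf : ContIntegrable f) (hc : 0 < c)
    (hδ : 1 ≤ δ) (ht : 0 < t) :
    volterraResolvent δ lam (fracTaylor ξ₀ ξ₁ c δ f) t
      = ξ₀ * (((t ^ (c - 1) : ℝ) : 𝕜) * mittagLeffler δ c (-lam * ((t ^ δ : ℝ) : 𝕜)))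
        + ξ₁ * (((t ^ c : ℝ) : 𝕜) * mittagLeffler δ (c + 1) (-lam * ((t ^ δ : ℝ) : 𝕜)))
        + ∫ τ in (0 : ℝ)..t, (((t - τ) ^ (δ - 1) : ℝ) : 𝕜)
          * mittagLeffler δ δ (-lam * (((t - τ) ^ δ : ℝ) : 𝕜)) * f τ := by
  have hc1 : 0 < c + 1 := by linarith
  have h₀ := (contIntegrable_rlKernel hc).ofReal.const_mul ξ₀
  have h₁ := (contIntegrable_rlKernel hc1).ofReal.const_mul ξ₁
  unfold fracTaylor
  rw [volterraResolvent_add (h₀.add h₁) (hf.rlIntegral (zero_le_one.trans hδ)) hδ ht,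
    volterraResolvent_add h₀ h₁ hδ ht, volterraResolvent_const_mul, volterraResolvent_const_mul,
    volterraResolvent_rlKernel lam hδ hc ht, volterraResolvent_rlKernel lam hδ hc1 ht,
    hf.volterraResolvent_rlIntegral hδ lam ht, add_sub_cancel_right]

end FracTaylor

theorem ContIntegrable.volterra_iff {𝕜 : Type*} [RCLike 𝕜] {g u : ℝ → 𝕜} {lam : 𝕜} {δ : ℝ}
    (hg : ContIntegrable g) (hδ : 1 ≤ δ) :
    (ContIntegrable u ∧ ∀ t, 0 < t → u t + lam * rlIntegral δ u t = g t) ↔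
      EqOn u (volterraResolvent δ lam g) (Ioi 0) := by
  refine ⟨fun ⟨hu, e⟩ => eqOn_volterraResolvent hg hu hδ e, fun e => ?_⟩
  refine ⟨(hg.volterraResolvent hδ).congr e.symm, fun t ht => ?_⟩
  rw [e ht, rlIntegral_congr (zero_le_one.trans hδ) ht e,
    hg.volterraResolvent_add_mul_rlIntegral hδ ht]

section Cauchy

variable {𝕜 : Type*} [RCLike 𝕜] {f u : ℝ → 𝕜} {ξ₀ ξ₁ lam : 𝕜} {γ β μ : ℝ}

theorem ContIntegrable.eqOn_rlIntegral_fracTaylor_one_two_iff {w h : ℝ → 𝕜} {a b δ : ℝ}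
    (hu : ContIntegrable u) (hw : ContIntegrable w) (ha : 0 ≤ a) (ha1 : a < 1) (hδ : 0 ≤ δ)
    (hb : 0 ≤ b) (hsum : a + (δ + b) = 2) (e : EqOn (rlIntegral b w) h (Ioi 0)) :
    EqOn (rlIntegral a u) (fracTaylor ξ₀ ξ₁ 1 2 w) (Ioi 0) ↔
      EqOn u (fracTaylor ξ₀ ξ₁ (1 - a) δ h) (Ioi 0) := by
  have htaylor := hu.eqOn_rlIntegral_fracTaylor_iff (ξ₀ := ξ₀) (ξ₁ := ξ₁) hw (sub_pos.2 ha1)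
    (add_nonneg hδ hb) ha ha1.le
  rw [sub_add_cancel, hsum] at htaylor
  exact htaylor.trans (forall₂_congr fun t ht => by
    rw [hw.fracTaylor_of_eqOn_rlIntegral hδ hb ht e])

theorem isHilferCauchySolution_iff_exists_taylor (hb : 0 ≤ μ * (2 - γ)) :
    IsHilferCauchySolution γ β μ lam ξ₀ ξ₁ f u ↔
      ContIntegrable u ∧ ∃ w, ContIntegrable w ∧
        EqOn (rlIntegral (μ * (2 - γ)) w) (fun t => f t - lam * u t) (Ioi 0) ∧
        EqOn (rlIntegral ((1 - μ) * (2 - β)) u) (fracTaylor ξ₀ ξ₁ 1 2 w) (Ioi 0) := by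
  constructor
  · intro hu
    have hw : ContIntegrable (iteratedDeriv 2 (rlIntegral ((1 - μ) * (2 - β)) u)) := by
      refine ⟨?_, hu.integrableOn_deriv2⟩
      exact (hu.contDiffOn.continuousOn_iteratedDerivWithin le_rfl isOpen_Ioi.uniqueDiffOn).congr
        (iteratedDerivWithin_of_isOpen isOpen_Ioi).symm
    refine ⟨⟨hu.continuousOn, hu.integrableOn⟩, _, hw, fun t ht => ?_,
      hw.eqOn_fracTaylor_one_two_iff.2
        ⟨⟨hu.contDiffOn, fun _ _ => rfl⟩, hu.initial_zero, hu.initial_one⟩⟩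
    exact eq_sub_of_add_eq (hu.equation t ht)
  · rintro ⟨hu, w, hw, hwf, hv⟩
    obtain ⟨⟨hC, hvw⟩, h0, h1⟩ := hw.eqOn_fracTaylor_one_two_iff.1 hv
    refine ⟨hu.continuousOn, hu.integrableOn, hC, (hw.congr hvw.symm).integrableOn,
      fun t ht => ?_, h0, h1⟩
    rw [hilferDeriv, Nat.cast_ofNat, rlIntegral_congr hb ht hvw, hwf ht, sub_add_cancel]

theorem ContIntegrable.isHilferCauchySolution_iff_volterra (hf : ContIntegrable f)
    (ha : 0 ≤ (1 - μ) * (2 - β)) (hb : 0 ≤ μ * (2 - γ)) (hδ : 1 < β + μ * (γ - β)) :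
    IsHilferCauchySolution γ β μ lam ξ₀ ξ₁ f u ↔
      (ContIntegrable u ∧ ∀ t, 0 < t → u t + lam * rlIntegral (β + μ * (γ - β)) u t
        = fracTaylor ξ₀ ξ₁ (1 - (1 - μ) * (2 - β)) (β + μ * (γ - β)) f t) ∧
      IsRLIntegral (μ * (2 - γ)) f := by
  have hsum : (1 - μ) * (2 - β) + (β + μ * (γ - β) + μ * (2 - γ)) = 2 := by ring
  rw [isHilferCauchySolution_iff_exists_taylor hb, and_assoc]
  generalize (1 - μ) * (2 - β) = a at *
  generalize μ * (2 - γ) = b at *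
  generalize β + μ * (γ - β) = δ at *
  refine and_congr_right fun hu => ?_
  have hδ0 : 0 ≤ δ := by linarith
  have hh := hf.sub (hu.const_mul lam)
  have hvolterra : (∀ t, 0 < t → u t + lam * rlIntegral δ u t = fracTaylor ξ₀ ξ₁ (1 - a) δ f t) ↔
      EqOn u (fracTaylor ξ₀ ξ₁ (1 - a) δ fun t => f t - lam * u t) (Ioi 0) :=
    forall₂_congr fun t ht => hf.add_mul_rlIntegral_eq_fracTaylor_iff hu hδ0 ht
  have htaylor {w : ℝ → 𝕜} (hw : ContIntegrable w)
      (e : EqOn (rlIntegral b w) (fun t => f t - lam * u t) (Ioi 0)) :=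
    hu.eqOn_rlIntegral_fracTaylor_one_two_iff (ξ₀ := ξ₀) (ξ₁ := ξ₁) hw ha (by linarith) hδ0 hb
      hsum e
  -- The fractional Taylor part of `u` is a fractional integral of order `b`, hence so is `u`.
  have hrange (e : EqOn u (fracTaylor ξ₀ ξ₁ (1 - a) δ fun t => f t - lam * u t) (Ioi 0)) :
      IsRLIntegral b (fun t => f t - lam * u t) ↔ IsRLIntegral b f :=
    ((hh.isRLIntegral_fracTaylor hb (by linarith) (by linarith)).congr e.symm).sub_const_mul_iff
      hb lam
  rw [hvolterra]
  constructor
  · rintro ⟨w, hw, hwf, hv⟩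
    have e := (htaylor hw hwf).1 hv
    exact ⟨e, (hrange e).1 ⟨w, hw, hwf⟩⟩
  · rintro ⟨e, hr⟩
    obtain ⟨w, hw, hwf⟩ := (hrange e).2 hr
    exact ⟨w, hw, hwf, (htaylor hw hwf).2 e⟩

theorem one_lt_add_mul_sub (hγ : 1 < γ) (hβ : 1 < β) (hμ : 0 ≤ μ) (hμ' : μ ≤ 1) :
    1 < β + μ * (γ - β) := by
  have := (convex_Ioi (1 : ℝ)).add_smul_sub_mem hβ hγ ⟨hμ, hμ'⟩
  simpa only [smul_eq_mul, mem_Ioi] using this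

theorem hilferCauchyFormula_eq_volterraResolvent (hf : ContIntegrable f)
    (hb : 0 ≤ μ * (2 - γ)) (hδ : 1 < β + μ * (γ - β)) {t : ℝ} (ht : 0 < t) :
    hilferCauchyFormula γ β μ lam ξ₀ ξ₁ f t
      = volterraResolvent (β + μ * (γ - β)) lam
          (fracTaylor ξ₀ ξ₁ (1 - (1 - μ) * (2 - β)) (β + μ * (γ - β)) f) t := by
  have hc : 0 < 1 - (1 - μ) * (2 - β) := by linarith
  rw [hf.volterraResolvent_fracTaylor hc hδ.le ht, hilferCauchyFormula,
    show (β - 2) * (1 - μ) = 1 - (1 - μ) * (2 - β) - 1 by ring,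
    show β + μ * (γ - β) + μ * (2 - γ) - 1 = 1 - (1 - μ) * (2 - β) by ring,
    show β + μ * (γ - β) + μ * (2 - γ) = 1 - (1 - μ) * (2 - β) + 1 by ring,
    show μ + (β - 1) * (1 - μ) = 1 - (1 - μ) * (2 - β) by ring, mul_assoc, mul_assoc]

end Cauchy

theorem theorem2p2_general {𝕜 : Type*} [RCLike 𝕜] {γ β μ : ℝ}
    (ha : 0 ≤ (1 - μ) * (2 - β)) (hb : 0 ≤ μ * (2 - γ)) (hδ : 1 < β + μ * (γ - β))
    {lam ξ₀ ξ₁ : 𝕜} {f u : ℝ → 𝕜}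
    (hf : ContinuousOn f (Ioi 0)) (hfint : IntegrableOn f (Ioc 0 1)) :
    IsHilferCauchySolution γ β μ lam ξ₀ ξ₁ f u ↔
      (∀ t, 0 < t → u t = hilferCauchyFormula γ β μ lam ξ₀ ξ₁ f t) ∧
        IsRLIntegral (μ * (2 - γ)) f := by
  have hf' : ContIntegrable f := .of_integrableOn_one hf hfint
  have hg : ContIntegrable
      (fracTaylor ξ₀ ξ₁ (1 - (1 - μ) * (2 - β)) (β + μ * (γ - β)) f) :=
    hf'.fracTaylor (by linarith) (by linarith)
  rw [hf'.isHilferCauchySolution_iff_volterra ha hb hδ, hg.volterra_iff hδ.le]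
  refine and_congr_left fun _ => forall₂_congr fun t ht => ?_
  rw [hilferCauchyFormula_eq_volterraResolvent hf' hb hδ ht]

theorem theorem2p2 {𝕜 : Type*} [RCLike 𝕜] (γ β μ : ℝ)
    (hγ : 1 < γ) (hγ' : γ ≤ 2) (hβ : 1 < β) (hβ' : β ≤ 2) (hμ : 0 ≤ μ) (hμ' : μ ≤ 1)
    (lam ξ₀ ξ₁ : 𝕜) (f : ℝ → 𝕜)
    (hf : ContDiffOn ℝ 1 f (Ioi 0)) (hfint : IntegrableOn f (Ioc 0 1)) :
    (∀ u : ℝ → 𝕜, IsHilferCauchySolution γ β μ lam ξ₀ ξ₁ f u →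
      ∀ t : ℝ, 0 < t → u t = hilferCauchyFormula γ β μ lam ξ₀ ξ₁ f t) ∧
    ((μ * (2 - γ) = 0 ∨
        IntegrableOn (fun t : ℝ => t ^ (1 - μ * (2 - γ)) • deriv f t) (Ioc 0 1)) →
      IsHilferCauchySolution γ β μ lam ξ₀ ξ₁ f
        (hilferCauchyFormula γ β μ lam ξ₀ ξ₁ f)) := by
  have ha : 0 ≤ (1 - μ) * (2 - β) := mul_nonneg (by linarith) (by linarith)
  have hb : 0 ≤ μ * (2 - γ) := mul_nonneg hμ (by linarith)
  have hb1 : μ * (2 - γ) < 1 := by nlinarith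
  have hsol {u} := theorem2p2_general (lam := lam) (ξ₀ := ξ₀) (ξ₁ := ξ₁) (u := u) ha hb
    (one_lt_add_mul_sub hγ hβ hμ hμ') hf.continuousOn hfint
  exact ⟨fun u hu => (hsol.1 hu).1, fun h => hsol.2
    ⟨fun _ _ => rfl, IsRLIntegral.of_contDiffOn hf hfint hb hb1 h⟩⟩
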